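/- Let $\mu_1,\mu_2,\rho:\mathbb R\to(0,\infty)$ be $1$-periodic and piecewise continuous (finitely many discontinuities per period, with finite strictly positive one-sided limits everywhere), and let $\omega,k\in\mathbb R$. Consider $$(\mu_1u')'-k^2\mu_2u=-\omega^2\rho u,\qquad\qquad(1)$$ with $u$ and $\mu_1u'$ absolutely continuous and the equation understood almost everywhere. With $\eta=(u,\,i\mu_1u')^{T}$ it reads $\eta'=\mathbf Q\eta$, $\mathbf Q=i\begin{pmatrix}0&-\mu_1^{-1}\\ \mu_2k^2-\rho\omega^2&0\end{pmatrix}$. Let $\mathbf M(y,y_0)=\mathbf I+\int_{y_0}^y\mathbf Q(s_1)\,ds_1+\int_{y_0}^y\mathbf Q(s_1)\int_{y_0}^{s_1}\mathbf Q(s_2)\,ds_2\,ds_1+\cdots$ be its matricant, and define $m_2(y)$ by letting $i\,m_2(y)$ be the upper right entry of $\mathbf M(y+1,y)$. For $K\in\mathbb R$ let $\omega_1^2(K,k)\le\omega_2^2(K,k)\le\cdots$ be the eigenvalues $\omega^2$, repeated according to multiplicity, of (1) on $[0,1]$ with the conditions $u(1)=e^{iK}u(0)$, $(\mu_1u')(1)=e^{iK}(\mu_1u')(0)$.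 The point $(\omega,k)$ is called a zero-width stopband if, for some integer $n\ge1$, $\omega^2=\omega_{2n}^2(0,k)=\omega_{2n+1}^2(0,k)$ or $\omega^2=\omega_{2n-1}^2(\pi,k)=\omega_{2n}^2(\pi,k)$. We call $\omega$ a Dirichlet frequency on $[y,y+1]$ if $\omega^2$ is an eigenvalue of (1) on $[y,y+1]$ with $u(y)=u(y+1)=0$, and the $n$-th Dirichlet frequency ($n\ge1$) if $\omega^2$ is the $n$-th of these eigenvalues in increasing order, repeated according to multiplicity. Then: 1. $(\omega,k)$ is a zero-width stopband if and only if $m_2(y)=0$ for all $y\in\mathbb R$. 2. $(\omega,k)$ is a zero-width stopband if and only if $\omega$ is a Dirichlet frequency on $[y,y+1]$ for every $y\in\mathbb R$. 3. Let $n\ge1$ and $y_0\in\mathbb R$, and suppose that $\omega$ is the $n$-th Dirichlet frequency on $[y_0,y_0+1]$. Then $(\omega,k)$ is a zero-width stopband if and only if $\omega$ is the $n$-th Dirichlet frequency on $[y,y+1]$ for every $y\in\mathbb R$, that is, if and only if the $n$-th Dirichlet frequency on $[y,y+1]$ does not depend on $y$. -/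

import Mathlib

open MeasureTheory Filter Topology

/-- A 1-periodic, strictly positive, piecewise continuous function on the real line:
finitely many discontinuities per period and finite, strictly positive one-sided limits
at every point. -/
structure IsPeriodicCoefficient (f : ℝ → ℝ) : Prop where
  periodic : Function.Periodic f 1
  pos : ∀ y, 0 < f y
  finite_disc : {y | y ∈ Set.Icc (0 : ℝ) 1 ∧ ¬ ContinuousAt f y}.Finite
  left_limit : ∀ y, ∃ a, 0 < a ∧ Tendsto f (𝓝[<] y) (𝓝 a)
  right_limit : ∀ y, ∃ a, 0 < a ∧ Tendsto f (𝓝[>] y) (𝓝 a)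

/-- The coefficients `μ₁`, `μ₂`, `ρ` of `(μ₁ u')' - k² μ₂ u = -ω² ρ u`. -/
structure PeriodicMedium where
  μ₁ : ℝ → ℝ
  μ₂ : ℝ → ℝ
  ρ : ℝ → ℝ
  hμ₁ : IsPeriodicCoefficient μ₁
  hμ₂ : IsPeriodicCoefficient μ₂
  hρ : IsPeriodicCoefficient ρ

namespace PeriodicMedium

noncomputable section

/-! ### The matricant and the function `m₂` -/

/-- The matrix `Q(y)` of the first order system `η' = Q η` for `η = (u, i μ₁ u')`. -/
def systemMatrix (c : PeriodicMedium) (ω k : ℝ) (y : ℝ) : Matrix (Fin 2) (Fin 2) ℂ :=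
  Complex.I • !![0, -((c.μ₁ y : ℂ))⁻¹; (c.μ₂ y : ℂ) * k ^ 2 - (c.ρ y : ℂ) * ω ^ 2, 0]

/-- The iterated integrals `∫_{y₀}^{y} Q(s₁) ∫_{y₀}^{s₁} Q(s₂) ⋯` (with `n` factors `Q`). -/
def peanoTerm (c : PeriodicMedium) (ω k : ℝ) (y₀ : ℝ) : ℕ → ℝ → Matrix (Fin 2) (Fin 2) ℂ
  | 0, _ => 1
  | n + 1, y => Matrix.of fun i j =>
      ∫ s in y₀..y, (c.systemMatrix ω k s * peanoTerm c ω k y₀ n s) i j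

/-- The matricant `M(y, y₀)`, given by its Peano series. -/
def matricant (c : PeriodicMedium) (ω k : ℝ) (y y₀ : ℝ) : Matrix (Fin 2) (Fin 2) ℂ :=
  ∑' n : ℕ, c.peanoTerm ω k y₀ n y

/-- `m₂(y)`: the upper right entry of the monodromy matrix `M(y + 1, y)` is `i m₂(y)`. -/
def m₂ (c : PeriodicMedium) (ω k : ℝ) (y : ℝ) : ℂ :=
  c.matricant ω k (y + 1) y 0 1 / Complex.I

/-! ### The Sturm-Liouville operator and its eigenvalues -/

/-- `u` lies in the maximal domain on `[a, a + 1]` and `v` is its quasi-derivative `μ₁ u'`: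
both are absolutely continuous. -/
def InDomain (c : PeriodicMedium) (a : ℝ) (u v : ℝ → ℂ) : Prop :=
  AbsolutelyContinuousOnInterval u a (a + 1) ∧
  AbsolutelyContinuousOnInterval v a (a + 1) ∧
  ∀ᵐ y ∂(volume.restrict (Set.Icc a (a + 1))), v y = (c.μ₁ y : ℂ) * deriv u y

/-- The differential expression `-(1/ρ) (μ₁ u')' + k² (μ₂/ρ) u`, where `v = μ₁ u'`. -/
def opA (c : PeriodicMedium) (k : ℝ) (u v : ℝ → ℂ) (y : ℝ) : ℂ :=
  -(1 / (c.ρ y : ℂ)) * deriv v y + (k : ℂ) ^ 2 * ((c.μ₂ y : ℂ) / (c.ρ y : ℂ)) * u y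

/-- The solutions, as functions on `[a, a + 1]`, of `A u = lam u` under the boundary condition
`bc u v` (with `v = μ₁ u'`); that is, the eigenfunctions for `lam` together with zero. -/
def eigenfunctions (c : PeriodicMedium) (k a : ℝ) (bc : (ℝ → ℂ) → (ℝ → ℂ) → Prop) (lam : ℝ) :
    Set (Set.Icc a (a + 1) → ℂ) :=
  {f | ∃ u v : ℝ → ℂ, c.InDomain a u v ∧ bc u v ∧
    (∀ᵐ y ∂(volume.restrict (Set.Icc a (a + 1))), c.opA k u v y = (lam : ℂ) * u y) ∧
    f = (Set.Icc a (a + 1)).domRestrict u}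

/-- `lam` is the `n`-th (`n = 1, 2, …`) real eigenvalue in increasing order, repeated according
to multiplicity: fewer than `n` eigenvalues lie in `(-∞, lam)`, and at least `n` in
`(-∞, lam]`. As eigenfunctions of distinct eigenvalues are linearly independent, the number of
eigenvalues in a set, with multiplicity, is the dimension of the span of their eigenfunctions. -/
def IsNthEigenvalue (c : PeriodicMedium) (k a : ℝ) (bc : (ℝ → ℂ) → (ℝ → ℂ) → Prop) (n : ℕ)
    (lam : ℝ) : Prop :=
  Module.rank ℂ (Submodule.span ℂ (⋃ ν ∈ Set.Iio lam, c.eigenfunctions k a bc ν)) < n ∧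
  (n : Cardinal) ≤
    Module.rank ℂ (Submodule.span ℂ (⋃ ν ∈ Set.Iic lam, c.eigenfunctions k a bc ν))

/-- Quasi-periodic boundary conditions `η(1) = e^{iK} η(0)`. -/
def floquetBC (K : ℝ) (u v : ℝ → ℂ) : Prop :=
  u 1 = Complex.exp (Complex.I * K) * u 0 ∧ v 1 = Complex.exp (Complex.I * K) * v 0

/-- Dirichlet conditions on `[a, a + 1]`. -/
def dirichletBC (a : ℝ) (u _v : ℝ → ℂ) : Prop :=
  u a = 0 ∧ u (a + 1) = 0

/-- `ω = ω_n(K, k)`: the number `ω²` is the `n`-th eigenvalue of `A_K(k)` on `[0, 1]`. -/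
def IsFloquetFrequency (c : PeriodicMedium) (n : ℕ) (K k ω : ℝ) : Prop :=
  c.IsNthEigenvalue k 0 (floquetBC K) n (ω ^ 2)

/-- `ω` is a Dirichlet frequency on `[a, a + 1]`. -/
def IsDirichletFrequency (c : PeriodicMedium) (k a ω : ℝ) : Prop :=
  ∃ f ∈ c.eigenfunctions k a (dirichletBC a) (ω ^ 2), f ≠ 0

/-- `ω` is the `n`-th Dirichlet frequency on `[a, a + 1]`. -/
def IsNthDirichletFrequency (c : PeriodicMedium) (n : ℕ) (k a ω : ℝ) : Prop :=
  c.IsNthEigenvalue k a (dirichletBC a) n (ω ^ 2)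

/-- Zero-width stopband: `ω = ω_{2n}(0, k) = ω_{2n+1}(0, k)` or
`ω = ω_{2n-1}(π, k) = ω_{2n}(π, k)` for some `n ≥ 1`. -/
def IsZeroWidthStopband (c : PeriodicMedium) (ω k : ℝ) : Prop :=
  ∃ n : ℕ, 1 ≤ n ∧
    ((c.IsFloquetFrequency (2 * n) 0 k ω ∧ c.IsFloquetFrequency (2 * n + 1) 0 k ω) ∨
     (c.IsFloquetFrequency (2 * n - 1) Real.pi k ω ∧ c.IsFloquetFrequency (2 * n) Real.pi k ω))

end

end PeriodicMedium

/-! Everything is read off the monodromy matrix at `lam = ω ^ 2`, whose columns are the values at 1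
of the solutions `C`, `S` with data (1, 0), (0, 1) at 0. All three statements reduce to one
condition: the monodromy matrix is `ε` times the identity with `ε = 1` or `ε = -1` (`IsScalar`).

Stopbands (`isZeroWidthStopband_iff`). Let `Δ` be the trace of the monodromy matrix. The eigenvalues
for `K = 0`, `π` are the zeros of `ε * Δ - 2`, and the geometric multiplicity, which is 2 exactly in
the scalar case, equals the order of the zero (`exists_floquet_factor`). Two equal consecutive
eigenvalues therefore force the scalar case. Conversely, a scalar point is a double eigenvalue, and
its index has the required parity: `Δ > 2` on the negative half-line, while `ε * Δ - 2 < 0` beside a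
scalar point, so the number of eigenvalues below it is odd for `ε = 1` and even for `ε = -1`.

Dirichlet problem (`isScalar_iff_dirichletFun`). Up to sign, `m₂ y` is the value at `y + 1` of the
solution with data (0, 1) at `y`. This is a quadratic form in `C y`, `S y` with coefficients from
the monodromy matrix, and it vanishes for all `y` only if that matrix is scalar.

Index (`ncard_zeros_eq`). Dirichlet eigenvalues are simple and move continuously with `y` without
colliding. If `ω ^ 2` is an eigenvalue for every `y`, none can cross it, so the number below it is
constant.

The Lagrange identity supplies every factorization in the spectral parameter, in place of
differentiation. -/

namespace IsPeriodicCoefficient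

/-! ### Bounds and discontinuities of a coefficient. -/

variable {f : ℝ → ℝ}

/-- The one-sided limits and the value at a point bound `f` near it, above and away from zero;
compactness of a period makes the bounds uniform. -/
theorem exists_bounds (hf : IsPeriodicCoefficient f) :
    ∃ m K : ℝ, 0 < m ∧ ∀ y, m ≤ f y ∧ f y ≤ K := by
  have loc : ∀ y : ℝ, ∃ m K : ℝ, 0 < m ∧ ∀ᶠ z in 𝓝 y, m ≤ f z ∧ f z ≤ K := by
    intro y
    obtain ⟨a, ha, hl⟩ := hf.left_limit y
    obtain ⟨b, hb, hr⟩ := hf.right_limit y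
    refine ⟨min (f y) (min (a / 2) (b / 2)), max (f y) (max (a + 1) (b + 1)),
      lt_min (hf.pos y) (lt_min (half_pos ha) (half_pos hb)), ?_⟩
    have h1 := hl.eventually (Icc_mem_nhds (half_lt_self ha) (lt_add_one a))
    have h2 := hr.eventually (Icc_mem_nhds (half_lt_self hb) (lt_add_one b))
    rw [eventually_nhdsWithin_iff] at h1 h2
    filter_upwards [h1, h2] with z hz1 hz2
    rcases lt_trichotomy z y with h | h | h
    · obtain ⟨h3, h4⟩ := hz1 h
      exact ⟨(min_le_right _ _).trans ((min_le_left _ _).trans h3),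
        h4.trans ((le_max_left _ _).trans (le_max_right _ _))⟩
    · rw [h]
      exact ⟨min_le_left _ _, le_max_left _ _⟩
    · obtain ⟨h3, h4⟩ := hz2 h
      exact ⟨(min_le_right _ _).trans ((min_le_right _ _).trans h3),
        h4.trans ((le_max_right _ _).trans (le_max_right _ _))⟩
  have glob : ∃ m K : ℝ, 0 < m ∧ ∀ y ∈ Set.Icc (0 : ℝ) 1, m ≤ f y ∧ f y ≤ K := by
    refine isCompact_Icc.induction_on (p := fun s => ∃ m K : ℝ, 0 < m ∧ ∀ y ∈ s, m ≤ f y ∧ f y ≤ K)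
      ⟨1, 1, one_pos, by simp⟩ ?_ ?_ ?_
    · rintro s t hst ⟨m, K, hm, h⟩
      exact ⟨m, K, hm, fun y hy => h y (hst hy)⟩
    · rintro s t ⟨m, K, hm, h⟩ ⟨m', K', hm', h'⟩
      refine ⟨min m m', max K K', lt_min hm hm', ?_⟩
      rintro y (hy | hy)
      · exact ⟨(min_le_left _ _).trans (h y hy).1, (h y hy).2.trans (le_max_left _ _)⟩
      · exact ⟨(min_le_right _ _).trans (h' y hy).1, (h' y hy).2.trans (le_max_right _ _)⟩
    · intro y _
      obtain ⟨m, K, hm, h⟩ := loc y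
      exact ⟨_, mem_nhdsWithin_of_mem_nhds h, m, K, hm, fun z hz => hz⟩
  obtain ⟨m, K, hm, h⟩ := glob
  refine ⟨m, K, hm, fun y => ?_⟩
  obtain ⟨z, hz, hzy⟩ := hf.periodic.exists_mem_Ico₀ one_pos y
  rw [hzy]
  exact h z (Set.Ico_subset_Icc_self hz)

theorem continuousAt_add_int (hf : IsPeriodicCoefficient f) {y : ℝ} (n : ℤ)
    (h : ContinuousAt f y) : ContinuousAt f (y + n) := by
  have h1 : f = fun z => f (z - n) := by
    funext z
    simpa using (hf.periodic.sub_zsmul_eq n (x := z)).symm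
  rw [h1]
  apply ContinuousAt.comp (g := f) (f := fun z : ℝ => z - n)
  · simpa using h
  · fun_prop

theorem countable_disc (hf : IsPeriodicCoefficient f) : {y | ¬ ContinuousAt f y}.Countable := by
  have h : {y | ¬ ContinuousAt f y} ⊆ ⋃ n : ℤ, (fun z : ℝ => z + n) ''
      {y | y ∈ Set.Icc (0 : ℝ) 1 ∧ ¬ ContinuousAt f y} := by
    intro y hy
    refine Set.mem_iUnion.2 ⟨⌊y⌋, y - ⌊y⌋, ⟨⟨?_, ?_⟩, ?_⟩, by simp⟩
    · linarith [Int.floor_le y]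
    · linarith [Int.lt_floor_add_one y]
    · intro h
      apply hy
      simpa using hf.continuousAt_add_int ⌊y⌋ h
  exact (Set.countable_iUnion fun n => hf.finite_disc.countable.image _).mono h

end IsPeriodicCoefficient

/-! ### Calculus off a countable exceptional set. -/

theorem aestronglyMeasurable_of_continuousAt_off_countable {E : Type*} [TopologicalSpace E]
    [TopologicalSpace.PseudoMetrizableSpace E] {g : ℝ → E} {S : Set ℝ} (hS : S.Countable)
    (hg : ∀ y ∉ S, ContinuousAt g y) : AEStronglyMeasurable g volume := by
  have h1 : AEStronglyMeasurable g (volume.restrict Sᶜ) :=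
    ContinuousOn.aestronglyMeasurable (fun y hy => (hg y hy).continuousWithinAt)
      hS.measurableSet.compl
  have h2 : (volume : Measure ℝ).restrict Sᶜ = volume := by
    rw [Measure.restrict_eq_self_of_ae_mem]
    exact (hS.ae_notMem volume).mono fun y hy => hy
  rwa [h2] at h1

theorem intervalIntegrable_of_bounded_off_countable {E : Type*} [NormedAddCommGroup E]
    {g : ℝ → E} {S : Set ℝ} (hS : S.Countable)
    (hg : ∀ y ∉ S, ContinuousAt g y) {K : ℝ} (hK : ∀ y, ‖g y‖ ≤ K) (a b : ℝ) :
    IntervalIntegrable g volume a b := by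
  refine (intervalIntegrable_const (c := K)).mono_fun
    (aestronglyMeasurable_of_continuousAt_off_countable hS hg).restrict ?_
  exact ae_of_all _ fun y => (hK y).trans (le_abs_self K)

theorem monotoneOn_of_deriv_nonneg_off_countable {g g' : ℝ → ℝ} {S : Set ℝ} (hS : S.Countable)
    (hg : Continuous g) (hd : ∀ y ∉ S, HasDerivAt g (g' y) y) {a b : ℝ} (hab : a ≤ b)
    (hi : IntervalIntegrable g' volume a b) (hn : ∀ y ∈ Set.Icc a b, 0 ≤ g' y) : g a ≤ g b := by
  have h := integral_eq_of_hasDerivAt_off_countable_of_le g g' hab hS hg.continuousOn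
    (fun y hy => hd y hy.2) hi
  have h2 : 0 ≤ ∫ y in a..b, g' y := intervalIntegral.integral_nonneg hab hn
  linarith

theorem eq_of_deriv_zero_off_countable {g : ℝ → ℝ} {S : Set ℝ} (hS : S.Countable)
    (hg : Continuous g) (hd : ∀ y ∉ S, HasDerivAt g 0 y) (a b : ℝ) : g b = g a := by
  have h := integral_eq_of_hasDerivAt_off_countable g (fun _ => 0) (a := a) (b := b) hS
    hg.continuousOn (fun y hy => hd y hy.2) intervalIntegrable_const
  simp at h
  linarith

theorem intervalIntegrable_mul_continuous {𝔸 : Type*} [NormedRing 𝔸] {Q : ℝ → 𝔸} {S : Set ℝ}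
    {K : ℝ} (hS : S.Countable) (hQ : ∀ y ∉ S, ContinuousAt Q y)
    (hK : ∀ y, ‖Q y‖ ≤ K) {g : ℝ → 𝔸} (hg : Continuous g) (a b : ℝ) :
    IntervalIntegrable (fun s => Q s * g s) volume a b :=
  (intervalIntegrable_of_bounded_off_countable hS hQ hK a b).mul_continuousOn hg.continuousOn

/-! ### The Peano series in a Banach algebra. -/

section Peano

variable {𝔸 : Type*} [NormedRing 𝔸] [NormedAlgebra ℝ 𝔸]
  {Q : ℝ → 𝔸} {S : Set ℝ} {K y₀ : ℝ} {P : ℕ → ℝ → 𝔸}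

theorem peano_continuous (hS : S.Countable) (hQ : ∀ y ∉ S, ContinuousAt Q y)
    (hK : ∀ y, ‖Q y‖ ≤ K) (h0 : ∀ y, P 0 y = 1)
    (hs : ∀ n y, P (n + 1) y = ∫ s in y₀..y, Q s * P n s) (n : ℕ) : Continuous (P n) := by
  induction n with
  | zero => rw [show P 0 = fun _ => 1 from funext h0]; exact continuous_const
  | succ n ih =>
    rw [show P (n + 1) = fun y => ∫ s in y₀..y, Q s * P n s from funext (hs n)]
    exact intervalIntegral.continuous_primitive
      (fun a b => intervalIntegrable_mul_continuous hS hQ hK ih a b) y₀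

/-- Each integration of `|s - y₀| ^ n` contributes a factor `1 / (n + 1)`, whence the factorial. The
factor `‖1‖` stays because `NormOneClass` is not assumed. -/
theorem peano_norm_le (hS : S.Countable) (hQ : ∀ y ∉ S, ContinuousAt Q y)
    (hK : ∀ y, ‖Q y‖ ≤ K) (h0 : ∀ y, P 0 y = 1)
    (hs : ∀ n y, P (n + 1) y = ∫ s in y₀..y, Q s * P n s) (n : ℕ) (y : ℝ) :
    ‖P n y‖ ≤ ‖(1 : 𝔸)‖ * ((K * |y - y₀|) ^ n / n.factorial) := by
  have hK0 : 0 ≤ K := (norm_nonneg _).trans (hK 0)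
  induction n generalizing y with
  | zero => simp [h0]
  | succ n ih =>
    rw [hs]
    calc ‖∫ s in y₀..y, Q s * P n s‖ ≤ ∫ s in Set.uIoc y₀ y, ‖Q s * P n s‖ :=
          intervalIntegral.norm_integral_le_integral_norm_uIoc
      _ ≤ ∫ s in Set.uIoc y₀ y, K * (‖(1 : 𝔸)‖ * (K ^ n / n.factorial)) * |s - y₀| ^ n := by
          apply integral_mono
          · exact ((intervalIntegrable_mul_continuous hS hQ hK
              (peano_continuous hS hQ hK h0 hs n) y₀ y).def').norm
          · exact ((by fun_prop : Continuous fun s : ℝ =>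
              K * (‖(1 : 𝔸)‖ * (K ^ n / n.factorial)) * |s - y₀| ^ n).intervalIntegrable y₀ y).def'
          · intro s
            calc ‖Q s * P n s‖ ≤ ‖Q s‖ * ‖P n s‖ := norm_mul_le _ _
              _ ≤ K * (‖(1 : 𝔸)‖ * ((K * |s - y₀|) ^ n / n.factorial)) := by
                gcongr
                · exact hK s
                · exact ih s
              _ = _ := by rw [mul_pow]; ring
      _ = _ := by
          rw [integral_const_mul, integral_pow_abs_sub_uIoc, Nat.factorial_succ]
          push_cast
          have : (n.factorial : ℝ) ≠ 0 := by positivity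
          field_simp
          ring

theorem peano_norm_le_of_abs_le (hS : S.Countable) (hQ : ∀ y ∉ S, ContinuousAt Q y)
    (hK : ∀ y, ‖Q y‖ ≤ K) (h0 : ∀ y, P 0 y = 1)
    (hs : ∀ n y, P (n + 1) y = ∫ s in y₀..y, Q s * P n s) (n : ℕ) {y R : ℝ}
    (hy : |y - y₀| ≤ R) :
    ‖P n y‖ ≤ ‖(1 : 𝔸)‖ * ((K * R) ^ n / n.factorial) := by
  have hK0 : 0 ≤ K := (norm_nonneg _).trans (hK 0)
  refine (peano_norm_le hS hQ hK h0 hs n y).trans ?_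
  gcongr

variable [CompleteSpace 𝔸]

theorem peano_summable (hS : S.Countable) (hQ : ∀ y ∉ S, ContinuousAt Q y)
    (hK : ∀ y, ‖Q y‖ ≤ K) (h0 : ∀ y, P 0 y = 1)
    (hs : ∀ n y, P (n + 1) y = ∫ s in y₀..y, Q s * P n s) (y : ℝ) :
    Summable fun n => P n y :=
  Summable.of_norm_bounded ((Real.summable_pow_div_factorial _).mul_left _)
    fun n => peano_norm_le hS hQ hK h0 hs n y

theorem peano_tsum_continuous (hS : S.Countable) (hQ : ∀ y ∉ S, ContinuousAt Q y)
    (hK : ∀ y, ‖Q y‖ ≤ K) (h0 : ∀ y, P 0 y = 1)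
    (hs : ∀ n y, P (n + 1) y = ∫ s in y₀..y, Q s * P n s) :
    Continuous fun y => ∑' n, P n y := by
  rw [continuous_iff_continuousAt]
  intro y
  have h : ContinuousOn (fun y => ∑' n, P n y) (Metric.ball y₀ (|y - y₀| + 1)) := by
    refine continuousOn_tsum (fun n => (peano_continuous hS hQ hK h0 hs n).continuousOn)
      ((Real.summable_pow_div_factorial (K * (|y - y₀| + 1))).mul_left ‖(1 : 𝔸)‖) ?_
    intro n z hz
    exact peano_norm_le_of_abs_le hS hQ hK h0 hs n (le_of_lt (by simpa [Real.dist_eq] using hz))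
  exact h.continuousAt (Metric.isOpen_ball.mem_nhds (by simp [Real.dist_eq]))

/-- Dominated convergence, with the factorial bounds taken uniformly on the interval, permits
termwise integration; the recursion then shifts the index by one. -/
theorem peano_tsum_eq (hS : S.Countable) (hQ : ∀ y ∉ S, ContinuousAt Q y)
    (hK : ∀ y, ‖Q y‖ ≤ K) (h0 : ∀ y, P 0 y = 1)
    (hs : ∀ n y, P (n + 1) y = ∫ s in y₀..y, Q s * P n s) (y : ℝ) :
    ∑' n, P n y = 1 + ∫ s in y₀..y, Q s * ∑' n, P n s := by
  have hK0 : 0 ≤ K := (norm_nonneg _).trans (hK 0)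
  have h : HasSum (fun n => ∫ s in y₀..y, Q s * P n s) (∫ s in y₀..y, Q s * ∑' n, P n s) := by
    refine intervalIntegral.hasSum_integral_of_dominated_convergence
      (fun n _ => K * (‖(1 : 𝔸)‖ * ((K * |y - y₀|) ^ n / n.factorial))) ?_ ?_ ?_ ?_ ?_
    · intro n
      exact (intervalIntegrable_mul_continuous hS hQ hK
        (peano_continuous hS hQ hK h0 hs n) y₀ y).def'.aestronglyMeasurable
    · intro n
      refine ae_of_all _ fun s hsm => (norm_mul_le _ _).trans ?_
      gcongr
      · exact hK s
      · refine peano_norm_le_of_abs_le hS hQ hK h0 hs n ?_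
        exact Set.abs_sub_left_of_mem_uIcc (Set.uIoc_subset_uIcc hsm)
    · exact ae_of_all _ fun s _ =>
        ((Real.summable_pow_div_factorial _).mul_left _).mul_left _
    · exact intervalIntegrable_const
    · exact ae_of_all _ fun s _ => (peano_summable hS hQ hK h0 hs s).hasSum.mul_left _
  rw [(peano_summable hS hQ hK h0 hs y).tsum_eq_zero_add, h0]
  congr 1
  rw [← h.tsum_eq]
  exact tsum_congr fun n => hs n y

theorem peano_tsum_initial (hS : S.Countable) (hQ : ∀ y ∉ S, ContinuousAt Q y)
    (hK : ∀ y, ‖Q y‖ ≤ K) (h0 : ∀ y, P 0 y = 1)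
    (hs : ∀ n y, P (n + 1) y = ∫ s in y₀..y, Q s * P n s) : ∑' n, P n y₀ = 1 := by
  rw [peano_tsum_eq hS hQ hK h0 hs]
  simp

theorem peano_tsum_hasDerivAt (hS : S.Countable) (hQ : ∀ y ∉ S, ContinuousAt Q y)
    (hK : ∀ y, ‖Q y‖ ≤ K) (h0 : ∀ y, P 0 y = 1)
    (hs : ∀ n y, P (n + 1) y = ∫ s in y₀..y, Q s * P n s) {y : ℝ} (hy : y ∉ S) :
    HasDerivAt (fun y => ∑' n, P n y) (Q y * ∑' n, P n y) y := by
  rw [show (fun y => ∑' n, P n y) = fun y => 1 + ∫ s in y₀..y, Q s * ∑' n, P n s from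
    funext (peano_tsum_eq hS hQ hK h0 hs)]
  apply HasDerivAt.const_add
  have hc := peano_tsum_continuous hS hQ hK h0 hs
  refine intervalIntegral.integral_hasDerivAt_right
    (intervalIntegrable_mul_continuous hS hQ hK hc y₀ y) ?_ ((hQ y hy).mul hc.continuousAt)
  exact ((aestronglyMeasurable_of_continuousAt_off_countable hS hQ).mul
    hc.aestronglyMeasurable).stronglyMeasurableAtFilter

end Peano

/-! ### Real solutions and their joint continuity in position and spectral parameter. -/

namespace PeriodicMedium

/-- The points where one of the coefficients is discontinuous. -/
def discSet (c : PeriodicMedium) : Set ℝ :=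
  {y | ¬ ContinuousAt c.μ₁ y} ∪ {y | ¬ ContinuousAt c.μ₂ y} ∪ {y | ¬ ContinuousAt c.ρ y}

/-- The coefficient `q` of the equation `(μ₁ u')' = q u`, for the spectral parameter `lam`. -/
def potential (c : PeriodicMedium) (k lam y : ℝ) : ℝ :=
  k ^ 2 * c.μ₂ y - lam * c.ρ y

variable (c : PeriodicMedium) {k lam : ℝ}

theorem countable_discSet : c.discSet.Countable :=
  (c.hμ₁.countable_disc.union c.hμ₂.countable_disc).union c.hρ.countable_disc

variable {c} in
theorem continuousAt_of_notMem_discSet {y : ℝ} (hy : y ∉ c.discSet) :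
    ContinuousAt c.μ₁ y ∧ ContinuousAt c.μ₂ y ∧ ContinuousAt c.ρ y := by
  simpa [discSet, and_assoc] using hy

theorem continuousAt_inv {y : ℝ} (hy : y ∉ c.discSet) :
    ContinuousAt (fun y => (c.μ₁ y)⁻¹) y :=
  (continuousAt_of_notMem_discSet hy).1.inv₀ (c.hμ₁.pos y).ne'

theorem continuousAt_potential {y : ℝ} (hy : y ∉ c.discSet) :
    ContinuousAt (c.potential k lam) y :=
  ((continuousAt_of_notMem_discSet hy).2.1.const_mul _).sub
    ((continuousAt_of_notMem_discSet hy).2.2.const_mul _)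

theorem exists_bound : ∃ K : ℝ, 0 ≤ K ∧ ∀ y, |(c.μ₁ y)⁻¹| ≤ K ∧ |c.μ₂ y| ≤ K ∧ |c.ρ y| ≤ K := by
  obtain ⟨m₁, K₁, hm₁, h₁⟩ := c.hμ₁.exists_bounds
  obtain ⟨m₂, K₂, hm₂, h₂⟩ := c.hμ₂.exists_bounds
  obtain ⟨m₃, K₃, hm₃, h₃⟩ := c.hρ.exists_bounds
  refine ⟨max (m₁⁻¹) (max K₂ K₃), (inv_pos.2 hm₁).le.trans (le_max_left _ _), fun y => ⟨?_, ?_, ?_⟩⟩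
  · rw [abs_of_pos (inv_pos.2 (c.hμ₁.pos y))]
    exact (inv_anti₀ hm₁ (h₁ y).1).trans (le_max_left _ _)
  · rw [abs_of_pos (c.hμ₂.pos y)]
    exact (h₂ y).2.trans ((le_max_left _ _).trans (le_max_right _ _))
  · rw [abs_of_pos (c.hρ.pos y)]
    exact (h₃ y).2.trans ((le_max_right _ _).trans (le_max_right _ _))

theorem exists_bound_inv : ∃ K : ℝ, ∀ y, ‖(c.μ₁ y)⁻¹‖ ≤ K := by
  obtain ⟨K, -, h⟩ := c.exists_bound
  exact ⟨K, fun y => (h y).1⟩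

theorem exists_bound_density : ∃ K : ℝ, ∀ y, ‖c.ρ y‖ ≤ K := by
  obtain ⟨K, -, h⟩ := c.exists_bound
  exact ⟨K, fun y => (h y).2.2⟩

theorem exists_bound_potential (k lam : ℝ) : ∃ K : ℝ, ∀ y, ‖c.potential k lam y‖ ≤ K := by
  obtain ⟨K, hK, h⟩ := c.exists_bound
  refine ⟨k ^ 2 * K + |lam| * K, fun y => (norm_sub_le _ _).trans ?_⟩
  rw [norm_mul, norm_mul, Real.norm_of_nonneg (sq_nonneg k)]
  simp only [Real.norm_eq_abs]
  gcongr
  · exact (h y).2.1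
  · exact (h y).2.2

theorem intervalIntegrable_inv (a b : ℝ) :
    IntervalIntegrable (fun y => (c.μ₁ y)⁻¹) volume a b := by
  obtain ⟨K, h⟩ := c.exists_bound_inv
  exact intervalIntegrable_of_bounded_off_countable c.countable_discSet
    (fun y hy => c.continuousAt_inv hy) h a b

theorem intervalIntegrable_potential (k lam a b : ℝ) :
    IntervalIntegrable (c.potential k lam) volume a b := by
  obtain ⟨K, h⟩ := c.exists_bound_potential k lam
  exact intervalIntegrable_of_bounded_off_countable c.countable_discSet
    (fun y hy => c.continuousAt_potential hy) h a b

theorem intervalIntegrable_density (a b : ℝ) : IntervalIntegrable c.ρ volume a b := by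
  obtain ⟨K, h⟩ := c.exists_bound_density
  exact intervalIntegrable_of_bounded_off_countable c.countable_discSet
    (fun y hy => (continuousAt_of_notMem_discSet hy).2.2) h a b

/-- `u` is a global real solution of `(μ₁ u')' = q u` with quasi-derivative `v = μ₁ u'`. -/
structure IsSolution (k lam : ℝ) (u v : ℝ → ℝ) : Prop where
  cont_fst : Continuous u
  cont_snd : Continuous v
  deriv_fst : ∀ y ∉ c.discSet, HasDerivAt u ((c.μ₁ y)⁻¹ * v y) y
  deriv_snd : ∀ y ∉ c.discSet, HasDerivAt v (c.potential k lam y * u y) y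

namespace IsSolution

variable {c} {u v u' v' : ℝ → ℝ}

theorem lin_comb (h : c.IsSolution k lam u v) (h' : c.IsSolution k lam u' v') (α β : ℝ) :
    c.IsSolution k lam (fun y => α * u y + β * u' y) (fun y => α * v y + β * v' y) where
  cont_fst := (h.cont_fst.const_mul α).add (h'.cont_fst.const_mul β)
  cont_snd := (h.cont_snd.const_mul α).add (h'.cont_snd.const_mul β)
  deriv_fst y hy := (((h.deriv_fst y hy).const_mul α).add
    ((h'.deriv_fst y hy).const_mul β)).congr_deriv (by ring)
  deriv_snd y hy := (((h.deriv_snd y hy).const_mul α).add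
    ((h'.deriv_snd y hy).const_mul β)).congr_deriv (by ring)

theorem comp_add_one (h : c.IsSolution k lam u v) :
    c.IsSolution k lam (fun y => u (y + 1)) (fun y => v (y + 1)) := by
  have hd : ∀ y ∉ c.discSet, y + 1 ∉ c.discSet := by
    intro y hy
    have h := continuousAt_of_notMem_discSet hy
    have h1 := c.hμ₁.continuousAt_add_int 1 h.1
    have h2 := c.hμ₂.continuousAt_add_int 1 h.2.1
    have h3 := c.hρ.continuousAt_add_int 1 h.2.2
    simp only [Int.cast_one] at h1 h2 h3
    simp [discSet, h1, h2, h3]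
  refine ⟨h.cont_fst.comp (by fun_prop), h.cont_snd.comp (by fun_prop), fun y hy => ?_,
    fun y hy => ?_⟩
  · have := (h.deriv_fst (y + 1) (hd y hy)).comp_add_const y 1
    rwa [c.hμ₁.periodic y] at this
  · have := (h.deriv_snd (y + 1) (hd y hy)).comp_add_const y 1
    rwa [potential, c.hμ₂.periodic y, c.hρ.periodic y] at this

theorem wronskian_const (h : c.IsSolution k lam u v) (h' : c.IsSolution k lam u' v') (a b : ℝ) :
    u b * v' b - v b * u' b = u a * v' a - v a * u' a := by
  refine eq_of_deriv_zero_off_countable (g := fun y => u y * v' y - v y * u' y)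
    c.countable_discSet ((h.cont_fst.mul h'.cont_snd).sub (h.cont_snd.mul h'.cont_fst)) ?_ a b
  intro y hy
  refine (((h.deriv_fst y hy).mul (h'.deriv_snd y hy)).sub
    ((h.deriv_snd y hy).mul (h'.deriv_fst y hy))).congr_deriv ?_
  ring

end IsSolution

/-- The Banach algebra is left arbitrary so that it can also be an algebra of functions of the
spectral parameter. -/
theorem exists_algebra_solution {𝔸 : Type*} [NormedRing 𝔸] [NormedAlgebra ℝ 𝔸]
    [CompleteSpace 𝔸] (A B D : 𝔸) : ∃ Y : ℝ → 𝔸, Continuous Y ∧ Y 0 = 1 ∧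
      ∀ y ∉ c.discSet, HasDerivAt Y (((c.μ₁ y)⁻¹ • A + c.μ₂ y • B + c.ρ y • D) * Y y) y := by
  obtain ⟨Q, hQdef⟩ : ∃ Q : ℝ → 𝔸, ∀ y, Q y = (c.μ₁ y)⁻¹ • A + c.μ₂ y • B + c.ρ y • D :=
    ⟨_, fun y => rfl⟩
  have hQ : ∀ y ∉ c.discSet, ContinuousAt Q y := by
    intro y hy
    have h := continuousAt_of_notMem_discSet hy
    rw [funext hQdef]
    exact (((c.continuousAt_inv hy).smul continuousAt_const).add
      (h.2.1.smul continuousAt_const)).add (h.2.2.smul continuousAt_const)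
  obtain ⟨K, hK0, hK⟩ := c.exists_bound
  have hQb : ∀ y, ‖Q y‖ ≤ K * ‖A‖ + K * ‖B‖ + K * ‖D‖ := by
    intro y
    rw [hQdef]
    refine norm_add₃_le.trans ?_
    rw [norm_smul, norm_smul, norm_smul]
    gcongr
    exacts [(hK y).1, (hK y).2.1, (hK y).2.2]
  obtain ⟨P, h0, hs⟩ : ∃ P : ℕ → ℝ → 𝔸, (∀ y, P 0 y = 1) ∧
      ∀ n y, P (n + 1) y = ∫ s in (0 : ℝ)..y, Q s * P n s :=
    ⟨fun n => Nat.rec (fun _ => 1) (fun _ f y => ∫ s in (0 : ℝ)..y, Q s * f s) n,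
      fun y => rfl, fun n y => rfl⟩
  have hS := c.countable_discSet
  refine ⟨fun y => ∑' n, P n y, peano_tsum_continuous hS hQ hQb h0 hs,
    peano_tsum_initial hS hQ hQb h0 hs, fun y hy => ?_⟩
  rw [← hQdef]
  exact peano_tsum_hasDerivAt hS hQ hQb h0 hs hy

/-- Solving once in `C(Set.Icc (-R) R, 𝔸)` treats all parameters together, so continuity in the
parameter comes for free. -/
theorem exists_algebra_solution_family {𝔸 : Type*} [NormedRing 𝔸] [NormedAlgebra ℝ 𝔸]
    [CompleteSpace 𝔸] (A B D : 𝔸) (R : ℝ) :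
    ∃ Y : ℝ → C(Set.Icc (-R) R, 𝔸), Continuous Y ∧ Y 0 = 1 ∧
      ∀ l : Set.Icc (-R) R, ∀ y ∉ c.discSet, HasDerivAt (fun y => Y y l)
        (((c.μ₁ y)⁻¹ • A + c.μ₂ y • B + c.ρ y • (l : ℝ) • D) * Y y l) y := by
  obtain ⟨Y, hc, hY0, hd⟩ := c.exists_algebra_solution (𝔸 := C(Set.Icc (-R) R, 𝔸))
    (ContinuousMap.const _ A) (ContinuousMap.const _ B) ⟨fun l => (l : ℝ) • D, by fun_prop⟩
  refine ⟨Y, hc, hY0, fun l y hy => ?_⟩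
  have h := (ContinuousMap.evalCLM ℝ l : C(Set.Icc (-R) R, 𝔸) →L[ℝ] 𝔸).hasFDerivAt.comp_hasDerivAt
    y (hd y hy)
  exact h

theorem exists_solution_family (k R : ℝ) :
    ∃ Y : ℝ → C(Set.Icc (-R) R, (ℝ × ℝ) →L[ℝ] (ℝ × ℝ)), Continuous Y ∧ Y 0 = 1 ∧
      ∀ l : Set.Icc (-R) R, ∀ e : ℝ × ℝ,
        c.IsSolution k l (fun y => (Y y l e).1) (fun y => (Y y l e).2) := by
  -- In `(u, v)' = (v / μ₁, (k² μ₂ - l ρ) u)` the operator `U` moves `v` to the first slot and `L`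
  -- moves `u` to the second.
  let U : (ℝ × ℝ) →L[ℝ] (ℝ × ℝ) := (ContinuousLinearMap.snd ℝ ℝ ℝ).prod 0
  let L : (ℝ × ℝ) →L[ℝ] (ℝ × ℝ) := (0 : (ℝ × ℝ) →L[ℝ] ℝ).prod (ContinuousLinearMap.fst ℝ ℝ ℝ)
  obtain ⟨Y, hc, hY0, hd⟩ := c.exists_algebra_solution_family U (k ^ 2 • L) (-L) R
  refine ⟨Y, hc, hY0, fun l e => ?_⟩
  have hev : Continuous fun y => Y y l e := by fun_prop
  have hd' : ∀ y ∉ c.discSet, HasDerivAt (fun y => Y y l e)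
      ((c.μ₁ y)⁻¹ * (Y y l e).2, c.potential k l y * (Y y l e).1) y := by
    intro y hy
    have h1 := (ContinuousLinearMap.apply ℝ (ℝ × ℝ) e).hasFDerivAt.comp_hasDerivAt y (hd l y hy)
    refine h1.congr_deriv ?_
    ext
    · simp [U, L]
    · simp [U, L, potential]
      ring
  exact ⟨continuous_fst.comp hev, continuous_snd.comp hev, fun y hy => (hd' y hy).fst,
    fun y hy => (hd' y hy).snd⟩

theorem exists_basis (k lam : ℝ) : ∃ u v u' v' : ℝ → ℝ, c.IsSolution k lam u v ∧
    c.IsSolution k lam u' v' ∧ u 0 = 1 ∧ v 0 = 0 ∧ u' 0 = 0 ∧ v' 0 = 1 := by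
  obtain ⟨Y, -, h0, hY⟩ := c.exists_solution_family k |lam|
  have hl : lam ∈ Set.Icc (-|lam|) |lam| := ⟨neg_abs_le lam, le_abs_self lam⟩
  exact ⟨_, _, _, _, hY ⟨lam, hl⟩ (1, 0), hY ⟨lam, hl⟩ (0, 1), by simp [h0], by simp [h0],
    by simp [h0], by simp [h0]⟩

variable {c} in
-- The Wronskians with two basis solutions vanish at `a`, hence everywhere; since the basis has
-- Wronskian 1, Cramer's rule gives zero.
theorem IsSolution.eq_zero {u v : ℝ → ℝ} (h : c.IsSolution k lam u v) {a : ℝ} (hu : u a = 0)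
    (hv : v a = 0) (y : ℝ) : u y = 0 ∧ v y = 0 := by
  obtain ⟨p, q, r, s, h1, h2, p0, q0, r0, s0⟩ := c.exists_basis k lam
  have e1 := h.wronskian_const h1 a y
  have e2 := h.wronskian_const h2 a y
  have e3 := h1.wronskian_const h2 0 y
  simp only [hu, hv, p0, q0, r0, s0] at e1 e2 e3
  constructor
  · linear_combination (-r y) * e1 + p y * e2 - u y * e3
  · linear_combination (-s y) * e1 + q y * e2 - v y * e3

variable {c} in
theorem IsSolution.unique {u v u' v' : ℝ → ℝ} (h : c.IsSolution k lam u v)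
    (h' : c.IsSolution k lam u' v') {a : ℝ} (hu : u a = u' a) (hv : v a = v' a) (y : ℝ) :
    u y = u' y ∧ v y = v' y := by
  have h1 := (h.lin_comb h' 1 (-1)).eq_zero (a := a) (by simp [hu]) (by simp [hv]) y
  exact ⟨by linarith [h1.1], by linarith [h1.2]⟩

/-- The solutions with initial values `(1, 0)` and `(0, 1)` at the origin, for all values of the
spectral parameter. -/
structure FundamentalSystem (c : PeriodicMedium) (k : ℝ) where
  C : ℝ → ℝ → ℝ
  Cv : ℝ → ℝ → ℝ
  S : ℝ → ℝ → ℝ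
  Sv : ℝ → ℝ → ℝ
  cont_C : Continuous fun z : ℝ × ℝ => C z.1 z.2
  cont_Cv : Continuous fun z : ℝ × ℝ => Cv z.1 z.2
  cont_S : Continuous fun z : ℝ × ℝ => S z.1 z.2
  cont_Sv : Continuous fun z : ℝ × ℝ => Sv z.1 z.2
  sol_C : ∀ lam, c.IsSolution k lam (C lam) (Cv lam)
  sol_S : ∀ lam, c.IsSolution k lam (S lam) (Sv lam)
  C_zero : ∀ lam, C lam 0 = 1
  Cv_zero : ∀ lam, Cv lam 0 = 0
  S_zero : ∀ lam, S lam 0 = 0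
  Sv_zero : ∀ lam, Sv lam 0 = 1

/-- By uniqueness the families on different intervals `[-R, R]` agree, so they glue; near `lam`
continuity is read off from `R = |lam| + 1`. -/
theorem exists_continuous_solutions (k : ℝ) (e : ℝ × ℝ) : ∃ u v : ℝ → ℝ → ℝ,
    Continuous (fun z : ℝ × ℝ => u z.1 z.2) ∧ Continuous (fun z : ℝ × ℝ => v z.1 z.2) ∧
    ∀ lam, c.IsSolution k lam (u lam) (v lam) ∧ u lam 0 = e.1 ∧ v lam 0 = e.2 := by
  choose Y hYc hY0 hY using fun R => c.exists_solution_family k R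
  have hl : ∀ lam : ℝ, lam ∈ Set.Icc (-|lam|) |lam| := fun lam => ⟨neg_abs_le lam, le_abs_self lam⟩
  have key : ∀ (R lam : ℝ) (hlam : lam ∈ Set.Icc (-R) R) (y : ℝ),
      Y |lam| y ⟨lam, hl lam⟩ e = Y R y ⟨lam, hlam⟩ e := by
    intro R lam hlam y
    have := (hY |lam| ⟨lam, hl lam⟩ e).unique (hY R ⟨lam, hlam⟩ e) (a := 0) (by simp [hY0])
      (by simp [hY0]) y
    exact Prod.ext this.1 this.2
  have hcont : Continuous fun z : ℝ × ℝ => Y |z.1| z.2 ⟨z.1, hl z.1⟩ e := by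
    rw [continuous_iff_continuousAt]
    rintro ⟨lam, y⟩
    have hR : -(|lam| + 1) ≤ |lam| + 1 := by linarith [abs_nonneg lam]
    have h1 : Continuous fun z : ℝ × ℝ => Y (|lam| + 1) z.2 (Set.projIcc _ _ hR z.1) e := by
      have := hYc (|lam| + 1)
      have h2 : Continuous fun z : ℝ × ℝ => Set.projIcc _ _ hR z.1 :=
        continuous_projIcc.comp continuous_fst
      fun_prop
    refine h1.continuousAt.congr ?_
    have h3 : ∀ᶠ z : ℝ × ℝ in 𝓝 (lam, y), |z.1| < |lam| + 1 :=
      (continuous_fst.abs.tendsto (lam, y)).eventually_lt_const (by simp)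
    filter_upwards [h3] with z hz
    have hz' : z.1 ∈ Set.Icc (-(|lam| + 1)) (|lam| + 1) := abs_le.1 hz.le
    rw [key _ z.1 hz', Set.projIcc_of_mem hR hz']
  refine ⟨fun lam y => (Y |lam| y ⟨lam, hl lam⟩ e).1, fun lam y => (Y |lam| y ⟨lam, hl lam⟩ e).2,
    continuous_fst.comp hcont, continuous_snd.comp hcont,
    fun lam => ⟨hY |lam| ⟨lam, hl lam⟩ e, ?_, ?_⟩⟩
  · simp [hY0]
  · simp [hY0]

theorem nonempty_fundamentalSystem (k : ℝ) : Nonempty (c.FundamentalSystem k) := by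
  obtain ⟨u, v, hu, hv, h⟩ := c.exists_continuous_solutions k (1, 0)
  obtain ⟨u', v', hu', hv', h'⟩ := c.exists_continuous_solutions k (0, 1)
  exact ⟨⟨u, v, u', v', hu, hv, hu', hv', fun l => (h l).1, fun l => (h' l).1, fun l => (h l).2.1,
    fun l => (h l).2.2, fun l => (h' l).2.1, fun l => (h' l).2.2⟩⟩

end PeriodicMedium

/-! ### The matricant as a solution of the differential system. -/

/-- A complex matrix as a real operator on `ℂ²`. -/
noncomputable def Matrix.toRealCLM (X : Matrix (Fin 2) (Fin 2) ℂ) :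
    (Fin 2 → ℂ) →L[ℝ] (Fin 2 → ℂ) :=
  (X.mulVecLin.restrictScalars ℝ).toContinuousLinearMap

/-- Evaluation of an operator on `ℂ²` at the vector `e`, followed by the `i`-th coordinate. -/
noncomputable def evalCoord (e : Fin 2 → ℂ) (i : Fin 2) :
    ((Fin 2 → ℂ) →L[ℝ] (Fin 2 → ℂ)) →L[ℝ] ℂ :=
  (ContinuousLinearMap.proj i).comp (ContinuousLinearMap.apply ℝ (Fin 2 → ℂ) e)

theorem evalCoord_apply (e : Fin 2 → ℂ) (i : Fin 2) (T : (Fin 2 → ℂ) →L[ℝ] (Fin 2 → ℂ)) :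
    evalCoord e i T = T e i := rfl

theorem Matrix.toRealCLM_apply (X : Matrix (Fin 2) (Fin 2) ℂ) (e : Fin 2 → ℂ) (i : Fin 2) :
    X.toRealCLM e i = X i 0 * e 0 + X i 1 * e 1 := by
  simp [toRealCLM, Matrix.mulVec, dotProduct, Fin.sum_univ_two]

theorem Matrix.toRealCLM_mul (X Y : Matrix (Fin 2) (Fin 2) ℂ) :
    (X * Y).toRealCLM = X.toRealCLM * Y.toRealCLM := by
  ext e i
  simp [toRealCLM]

theorem Matrix.toRealCLM_single (X : Matrix (Fin 2) (Fin 2) ℂ) (i j : Fin 2) :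
    X.toRealCLM (Pi.single j 1) i = X i j := by
  fin_cases j <;> simp [toRealCLM_apply]

namespace PeriodicMedium

variable (c : PeriodicMedium)

theorem systemMatrix_toRealCLM (ω k : ℝ) : ∃ A B D : (Fin 2 → ℂ) →L[ℝ] (Fin 2 → ℂ),
    ∀ y, (c.systemMatrix ω k y).toRealCLM = (c.μ₁ y)⁻¹ • A + c.μ₂ y • B + c.ρ y • D := by
  refine ⟨Matrix.toRealCLM (Complex.I • !![0, -1; 0, 0]),
    Matrix.toRealCLM (Complex.I • !![0, 0; (k : ℂ) ^ 2, 0]),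
    Matrix.toRealCLM (Complex.I • !![0, 0; -(ω : ℂ) ^ 2, 0]), fun y => ?_⟩
  ext e i
  fin_cases i <;> simp [Matrix.toRealCLM_apply, systemMatrix]
  · ring
  · ring

/-- Operators on `ℂ²` form a Banach algebra in which the Peano theory applies. Evaluating a
coordinate at a basis vector is a continuous linear functional, so it commutes with the integrals
and the sum and recovers the matrix entries. -/
theorem matricant_entries (ω k y₀ : ℝ) (i j : Fin 2) :
    Continuous (fun y => c.matricant ω k y y₀ i j) ∧
    c.matricant ω k y₀ y₀ i j = (1 : Matrix (Fin 2) (Fin 2) ℂ) i j ∧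
    ∀ y ∉ c.discSet, HasDerivAt (fun y => c.matricant ω k y y₀ i j)
      ((c.systemMatrix ω k y * c.matricant ω k y y₀) i j) y := by
  obtain ⟨A, B, D, hABD⟩ := c.systemMatrix_toRealCLM ω k
  obtain ⟨Q, hQdef⟩ : ∃ Q : ℝ → (Fin 2 → ℂ) →L[ℝ] (Fin 2 → ℂ),
    ∀ y, Q y = (c.systemMatrix ω k y).toRealCLM := ⟨_, fun y => rfl⟩
  have hQ : ∀ y ∉ c.discSet, ContinuousAt Q y := by
    intro y hy
    have h := continuousAt_of_notMem_discSet hy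
    rw [funext fun y => (hQdef y).trans (hABD y)]
    exact (((c.continuousAt_inv hy).smul continuousAt_const).add
      (h.2.1.smul continuousAt_const)).add (h.2.2.smul continuousAt_const)
  obtain ⟨K, hK0, hK⟩ := c.exists_bound
  have hQb : ∀ y, ‖Q y‖ ≤ K * ‖A‖ + K * ‖B‖ + K * ‖D‖ := by
    intro y
    rw [hQdef, hABD]
    refine norm_add₃_le.trans ?_
    rw [norm_smul, norm_smul, norm_smul]
    gcongr
    exacts [(hK y).1, (hK y).2.1, (hK y).2.2]
  obtain ⟨P, h0, hs⟩ : ∃ P : ℕ → ℝ → (Fin 2 → ℂ) →L[ℝ] (Fin 2 → ℂ), (∀ y, P 0 y = 1) ∧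
      ∀ n y, P (n + 1) y = ∫ s in y₀..y, Q s * P n s :=
    ⟨fun n => Nat.rec (fun _ => 1) (fun _ f y => ∫ s in y₀..y, Q s * f s) n,
      fun y => rfl, fun n y => rfl⟩
  have hS := c.countable_discSet
  have hint : ∀ n a b, IntervalIntegrable (fun s => Q s * P n s) volume a b := fun n =>
    intervalIntegrable_mul_continuous hS hQ hQb (peano_continuous hS hQ hQb h0 hs n)
  have hcomp : ∀ (T : ((Fin 2 → ℂ) →L[ℝ] (Fin 2 → ℂ)) →L[ℝ] ℂ) n y,
      IntervalIntegrable (fun s => T (Q s * P n s)) volume y₀ y := fun T n y =>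
    ⟨T.integrable_comp (hint n y₀ y).1, T.integrable_comp (hint n y₀ y).2⟩
  have hP : ∀ n y, (c.peanoTerm ω k y₀ n y).toRealCLM = P n y := by
    intro n
    induction n with
    | zero =>
      intro y
      rw [h0]
      ext e i
      fin_cases i <;> simp [peanoTerm, Matrix.toRealCLM_apply]
    | succ n ih =>
      intro y
      have hentry : ∀ s i j, (c.systemMatrix ω k s * c.peanoTerm ω k y₀ n s) i j =
          evalCoord (Pi.single j 1) i (Q s * P n s) := by
        intro s i j
        rw [evalCoord_apply, ← ih, hQdef, ← Matrix.toRealCLM_mul, Matrix.toRealCLM_single]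
      ext e i
      rw [Matrix.toRealCLM_apply, ← evalCoord_apply e i (P (n + 1) y), hs,
        ← (evalCoord e i).intervalIntegral_comp_comm (hint n y₀ y)]
      simp only [peanoTerm, Matrix.of_apply, hentry]
      rw [← intervalIntegral.integral_mul_const, ← intervalIntegral.integral_mul_const,
        ← intervalIntegral.integral_add]
      · refine intervalIntegral.integral_congr fun s _ => ?_
        rw [evalCoord_apply e, ← ih, hQdef, ← Matrix.toRealCLM_mul, Matrix.toRealCLM_apply,
          evalCoord_apply, evalCoord_apply, Matrix.toRealCLM_single, Matrix.toRealCLM_single]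
      · exact IntervalIntegrable.mul_const (hcomp _ n y) _
      · exact IntervalIntegrable.mul_const (hcomp _ n y) _
  have hsum : ∀ y (i j : Fin 2), HasSum (fun n => c.peanoTerm ω k y₀ n y i j)
      (evalCoord (Pi.single j 1) i (∑' n, P n y)) := by
    intro y i j
    have h := (evalCoord (Pi.single j 1) i).hasSum (peano_summable hS hQ hQb h0 hs y).hasSum
    simpa only [Function.comp_def, evalCoord_apply, ← hP, Matrix.toRealCLM_single] using h
  have hmat : ∀ y (i j : Fin 2), c.matricant ω k y y₀ i j =
      evalCoord (Pi.single j 1) i (∑' n, P n y) := by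
    intro y i j
    have h : HasSum (fun n => c.peanoTerm ω k y₀ n y)
        (Matrix.of fun i j => evalCoord (Pi.single j 1) i (∑' n, P n y)) :=
      Pi.hasSum.2 fun i => Pi.hasSum.2 fun j => hsum y i j
    rw [matricant, h.tsum_eq, Matrix.of_apply]
  have hclm : ∀ y, (c.matricant ω k y y₀).toRealCLM = ∑' n, P n y := by
    intro y
    ext e i
    rw [Matrix.toRealCLM_apply, hmat, hmat, ← evalCoord_apply e]
    have h := (evalCoord e i).hasSum (peano_summable hS hQ hQb h0 hs y).hasSum
    refine ((((hsum y i 0).mul_right (e 0)).add ((hsum y i 1).mul_right (e 1))).unique ?_)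
    simpa only [Function.comp_def, evalCoord_apply, ← hP, Matrix.toRealCLM_apply] using h
  refine ⟨?_, ?_, fun y hy => ?_⟩
  · simp only [hmat]
    exact (evalCoord _ i).continuous.comp (peano_tsum_continuous hS hQ hQb h0 hs)
  · rw [hmat, peano_tsum_initial hS hQ hQb h0 hs, evalCoord_apply, Matrix.one_apply]
    simp [Pi.single_apply]
  · have h := (evalCoord (Pi.single j 1) i).hasFDerivAt.comp_hasDerivAt y
      (peano_tsum_hasDerivAt hS hQ hQb h0 hs hy)
    rw [← hclm, hQdef, ← Matrix.toRealCLM_mul, evalCoord_apply, Matrix.toRealCLM_single] at h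
    exact h.congr_of_eventuallyEq (Eventually.of_forall fun y => hmat y i j)

/-- The second column `(U, V)` of the matricant splits into two real solutions: `(-Im U, Re V)` has
data (0, 1) and `(Re U, Im V)` has data (0, 0). Hence `U = -i u`, and dividing by `i` gives the
sign. -/
theorem m₂_eq {u v : ℝ → ℝ} {ω k y₀ : ℝ} (h : c.IsSolution k (ω ^ 2) u v) (hu : u y₀ = 0)
    (hv : v y₀ = 1) : c.m₂ ω k y₀ = -(u (y₀ + 1) : ℂ) := by
  obtain ⟨c0, i0, d0⟩ := c.matricant_entries ω k y₀ 0 1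
  obtain ⟨c1, i1, d1⟩ := c.matricant_entries ω k y₀ 1 1
  set U := fun y => c.matricant ω k y y₀ 0 1 with hU
  set V := fun y => c.matricant ω k y y₀ 1 1 with hV
  replace d0 : ∀ y ∉ c.discSet,
      HasDerivAt U (-Complex.I * (((c.μ₁ y)⁻¹ : ℝ) * V y)) y := fun y hy =>
    (d0 y hy).congr_deriv (by
      simp [systemMatrix, Matrix.mul_apply, Fin.sum_univ_two, hV, mul_assoc])
  replace d1 : ∀ y ∉ c.discSet,
      HasDerivAt V (Complex.I * ((c.potential k (ω ^ 2) y : ℝ) * U y)) y := fun y hy =>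
    (d1 y hy).congr_deriv (by
      simp [systemMatrix, Matrix.mul_apply, Fin.sum_univ_two, hU, potential]
      ring)
  have dre : ∀ (f : ℝ → ℂ) f' y, HasDerivAt f f' y → HasDerivAt (fun y => (f y).re) f'.re y :=
    fun f f' y h => Complex.reCLM.hasFDerivAt.comp_hasDerivAt y h
  have dim : ∀ (f : ℝ → ℂ) f' y, HasDerivAt f f' y → HasDerivAt (fun y => (f y).im) f'.im y :=
    fun f f' y h => Complex.imCLM.hasFDerivAt.comp_hasDerivAt y h
  have s1 : c.IsSolution k (ω ^ 2) (fun y => -(U y).im) (fun y => (V y).re) := by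
    refine ⟨(Complex.continuous_im.comp c0).neg, Complex.continuous_re.comp c1, fun y hy => ?_,
      fun y hy => ?_⟩
    · exact (dim _ _ _ (d0 y hy)).neg.congr_deriv (by simp)
    · exact (dre _ _ _ (d1 y hy)).congr_deriv (by simp)
  have s2 : c.IsSolution k (ω ^ 2) (fun y => (U y).re) (fun y => (V y).im) := by
    refine ⟨Complex.continuous_re.comp c0, Complex.continuous_im.comp c1, fun y hy => ?_,
      fun y hy => ?_⟩
    · exact (dre _ _ _ (d0 y hy)).congr_deriv (by simp)
    · exact (dim _ _ _ (d1 y hy)).congr_deriv (by simp)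
  have e1 := (s1.unique h (a := y₀) (by simp [hU, i0, hu]) (by simp [hV, i1, hv]) (y₀ + 1)).1
  have e2 := (s2.eq_zero (a := y₀) (by simp [hU, i0]) (by simp [hV, i1]) (y₀ + 1)).1
  have e3 : U (y₀ + 1) = -(u (y₀ + 1) : ℂ) * Complex.I := by
    apply Complex.ext
    · simpa using e2
    · simp at e1 ⊢
      linarith
  rw [m₂, show c.matricant ω k (y₀ + 1) y₀ 0 1 = U (y₀ + 1) from rfl, e3,
    mul_div_cancel_right₀ _ Complex.I_ne_zero]

end PeriodicMedium

/-! ### Energy and Lagrange identities, and solutions for negative parameter. -/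

theorem eq_zero_of_integral_mul_sq_nonpos {w g : ℝ → ℝ} {a b : ℝ} (hab : a < b)
    (hw : ∀ y, 0 < w y) (hi : IntervalIntegrable w volume a b) (hg : Continuous g)
    (h : ∫ y in a..b, w y * g y ^ 2 ≤ 0) : ∀ y ∈ Set.Icc a b, g y = 0 := by
  have hn : ∀ y, 0 ≤ w y * g y ^ 2 := fun y => mul_nonneg (hw y).le (sq_nonneg _)
  have hi' : IntervalIntegrable (fun y => w y * g y ^ 2) volume a b :=
    hi.mul_continuousOn (hg.pow 2).continuousOn
  have h0 : ∫ y in a..b, w y * g y ^ 2 = 0 :=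
    le_antisymm h (intervalIntegral.integral_nonneg hab.le fun y _ => hn y)
  rw [intervalIntegral.integral_eq_zero_iff_of_le_of_nonneg_ae hab.le
    (ae_of_all _ fun y => hn y) hi', ← Measure.restrict_congr_set Ioc_ae_eq_Icc.symm] at h0
  refine Measure.eqOn_Icc_of_ae_eq volume hab.ne (g := fun _ => 0) ?_ hg.continuousOn
    continuousOn_const
  filter_upwards [h0] with y hy
  simpa [(hw y).ne'] using hy

theorem exists_mem_Ioo_notMem_countable {S : Set ℝ} (hS : S.Countable) {a b : ℝ} (hab : a < b) :
    ∃ y ∈ Set.Ioo a b, y ∉ S := by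
  obtain ⟨y, hy, hyS⟩ := (hS.dense_compl ℝ).exists_between hab
  exact ⟨y, hyS, hy⟩

theorem exists_kernel_vector {F : Type*} [Field F] {a b c d : F} (h : a * d - b * c = 0) :
    ∃ x y : F, (x ≠ 0 ∨ y ≠ 0) ∧ a * x + b * y = 0 ∧ c * x + d * y = 0 := by
  by_cases hab : b ≠ 0 ∨ a ≠ 0
  · exact ⟨b, -a, by simpa using hab, by ring, by linear_combination -h⟩
  · push Not at hab
    by_cases hcd : d ≠ 0 ∨ c ≠ 0
    · exact ⟨d, -c, by simpa using hcd, by linear_combination h, by ring⟩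
    · push Not at hcd
      exact ⟨1, 0, by simp, by simp [hab], by simp [hcd]⟩

theorem one_le_of_one_le_sq {g : ℝ → ℝ} (hg : Continuous g) (h0 : g 0 = 1)
    (h : ∀ y, 0 ≤ y → 1 ≤ g y ^ 2) : 1 ≤ g 1 := by
  have hpos : 0 ≤ g 1 := by
    by_contra hneg
    push Not at hneg
    obtain ⟨y, hy, hy0⟩ := intermediate_value_Icc' zero_le_one hg.continuousOn
      (show (0 : ℝ) ∈ Set.Icc (g 1) (g 0) from ⟨hneg.le, by simp [h0]⟩)
    have := h y hy.1
    simp [hy0] at this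
    linarith
  nlinarith [h 1 zero_le_one]

namespace PeriodicMedium

variable {c : PeriodicMedium} {k lam lam' : ℝ} {u v u' v' : ℝ → ℝ}

theorem potential_pos (h : lam < 0) (y : ℝ) : 0 < c.potential k lam y := by
  have h1 := mul_nonneg (sq_nonneg k) (c.hμ₂.pos y).le
  have h2 := mul_pos_of_neg_of_neg h (neg_neg_of_pos (c.hρ.pos y))
  rw [potential]
  linarith

namespace IsSolution

/-- The derivative of the mixed Wronskian is `(lam - lam') ρ u u'`. This exact difference formula
yields the factors `l - l₀` used for all multiplicities below. -/
theorem lagrange (h : c.IsSolution k lam u v) (h' : c.IsSolution k lam' u' v') (a b : ℝ) :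
    (lam - lam') * ∫ y in a..b, c.ρ y * (u y * u' y) =
      u b * v' b - v b * u' b - (u a * v' a - v a * u' a) := by
  rw [← intervalIntegral.integral_const_mul]
  refine integral_eq_of_hasDerivAt_off_countable (fun y => u y * v' y - v y * u' y) _
    c.countable_discSet ((h.cont_fst.mul h'.cont_snd).sub
      (h.cont_snd.mul h'.cont_fst)).continuousOn ?_ ?_
  · intro y hy
    refine (((h.deriv_fst y hy.2).mul (h'.deriv_snd y hy.2)).sub
      ((h.deriv_snd y hy.2).mul (h'.deriv_fst y hy.2))).congr_deriv ?_
    simp only [potential]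
    ring
  · exact ((c.intervalIntegrable_density a b).mul_continuousOn
      (h.cont_fst.mul h'.cont_fst).continuousOn).const_mul _

theorem intervalIntegrable_energy (h : c.IsSolution k lam u v) (a b : ℝ) :
    IntervalIntegrable (fun y => (c.μ₁ y)⁻¹ * v y ^ 2 + c.potential k lam y * u y ^ 2)
      volume a b :=
  ((c.intervalIntegrable_inv a b).mul_continuousOn (h.cont_snd.pow 2).continuousOn).add
    ((c.intervalIntegrable_potential k lam a b).mul_continuousOn (h.cont_fst.pow 2).continuousOn)

theorem deriv_mul (h : c.IsSolution k lam u v) (y : ℝ) (hy : y ∉ c.discSet) :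
    HasDerivAt (fun y => u y * v y)
      ((c.μ₁ y)⁻¹ * v y ^ 2 + c.potential k lam y * u y ^ 2) y :=
  ((h.deriv_fst y hy).mul (h.deriv_snd y hy)).congr_deriv (by ring)

theorem eq_zero_of_eqOn (h : c.IsSolution k lam u v) {a b : ℝ} (hab : a < b)
    (h0 : ∀ y ∈ Set.Icc a b, u y = 0) (y : ℝ) : u y = 0 ∧ v y = 0 := by
  obtain ⟨z, hz, hzS⟩ := exists_mem_Ioo_notMem_countable c.countable_discSet hab
  have h1 : HasDerivAt u 0 z := by
    refine (hasDerivAt_const z (0 : ℝ)).congr_of_eventuallyEq ?_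
    filter_upwards [Icc_mem_nhds hz.1 hz.2] with y hy using h0 y hy
  have h2 := (h.deriv_fst z hzS).unique h1
  refine h.eq_zero (a := z) (h0 z (Set.Ioo_subset_Icc_self hz)) ?_ y
  simpa [(c.hμ₁.pos z).ne'] using h2

/-- For `lam < 0` the derivative of `u v` is a sum of two nonnegative terms. Equal end values make
its integral zero, so `u` vanishes on the interval. -/
theorem eq_zero_of_energy (h : c.IsSolution k lam u v) (hlam : lam < 0) {a b : ℝ} (hab : a < b)
    (he : u a * v a = u b * v b) (y : ℝ) : u y = 0 ∧ v y = 0 := by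
  have h1 := integral_eq_of_hasDerivAt_off_countable (fun y => u y * v y) _
    c.countable_discSet (h.cont_fst.mul h.cont_snd).continuousOn
    (fun y hy => h.deriv_mul y hy.2) (h.intervalIntegrable_energy a b)
  refine h.eq_zero_of_eqOn hab (eq_zero_of_integral_mul_sq_nonpos hab
    (fun y => potential_pos hlam y) (c.intervalIntegrable_potential k lam a b) h.cont_fst ?_) y
  calc ∫ y in a..b, c.potential k lam y * u y ^ 2
      ≤ ∫ y in a..b, ((c.μ₁ y)⁻¹ * v y ^ 2 + c.potential k lam y * u y ^ 2) := by
        refine intervalIntegral.integral_mono hab.le ((c.intervalIntegrable_potential k lam a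
          b).mul_continuousOn (h.cont_fst.pow 2).continuousOn) (h.intervalIntegrable_energy a b) ?_
        intro y
        have := mul_nonneg (inv_pos.2 (c.hμ₁.pos y)).le (sq_nonneg (v y))
        simp only
        linarith
    _ = 0 := by rw [h1]; simp [he]

theorem mul_nonneg_of_neg (h : c.IsSolution k lam u v) (hlam : lam < 0) (h0 : u 0 * v 0 = 0)
    {y : ℝ} (hy : 0 ≤ y) : 0 ≤ u y * v y := by
  rw [← h0]
  refine monotoneOn_of_deriv_nonneg_off_countable (g := fun y => u y * v y) c.countable_discSet
    (h.cont_fst.mul h.cont_snd) h.deriv_mul hy (h.intervalIntegrable_energy 0 y) fun z _ => ?_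
  have := (c.hμ₁.pos z)
  have := potential_pos (c := c) (k := k) hlam z
  positivity

/-- The product `u v` starts at zero and increases, so `u ^ 2`, with derivative `2 u v / μ₁`,
increases from 1. -/
theorem one_le_fst (h : c.IsSolution k lam u v) (hlam : lam < 0) (hu : u 0 = 1) (hv : v 0 = 0) :
    1 ≤ u 1 := by
  refine one_le_of_one_le_sq h.cont_fst hu fun y hy => ?_
  have h1 : u 0 ^ 2 ≤ u y ^ 2 := by
    refine monotoneOn_of_deriv_nonneg_off_countable (g := fun y => u y ^ 2)
      (g' := fun y => (c.μ₁ y)⁻¹ * (2 * (u y * v y))) c.countable_discSet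
      (h.cont_fst.pow 2) (fun y hy => ((h.deriv_fst y hy).pow 2).congr_deriv (by ring)) hy
      ((c.intervalIntegrable_inv 0 y).mul_continuousOn
        ((h.cont_fst.mul h.cont_snd).const_mul 2).continuousOn) fun z hz => ?_
    have h1 := h.mul_nonneg_of_neg hlam (by simp [hv]) hz.1
    have := (c.hμ₁.pos z)
    positivity
  simpa [hu] using h1

theorem one_le_snd (h : c.IsSolution k lam u v) (hlam : lam < 0) (hu : u 0 = 0) (hv : v 0 = 1) :
    1 ≤ v 1 := by
  refine one_le_of_one_le_sq h.cont_snd hv fun y hy => ?_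
  have h1 : v 0 ^ 2 ≤ v y ^ 2 := by
    refine monotoneOn_of_deriv_nonneg_off_countable (g := fun y => v y ^ 2)
      (g' := fun y => c.potential k lam y * (2 * (u y * v y))) c.countable_discSet
      (h.cont_snd.pow 2) (fun y hy => ((h.deriv_snd y hy).pow 2).congr_deriv (by ring)) hy
      ((c.intervalIntegrable_potential k lam 0 y).mul_continuousOn
        ((h.cont_fst.mul h.cont_snd).const_mul 2).continuousOn) fun z hz => ?_
    have h1 := h.mul_nonneg_of_neg hlam (by simp [hu]) hz.1
    have := potential_pos (c := c) (k := k) hlam z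
    positivity
  simpa [hv] using h1

end IsSolution

/-- The integrand may jump in `x`, but for fixed `x₀` the point `a x₀ + y` is a discontinuity of `ρ`
for only countably many `y`, so dominated convergence applies. -/
theorem continuous_integral_density {X : Type*} [TopologicalSpace X] [FirstCountableTopology X]
    [WeaklyLocallyCompactSpace X] {a : X → ℝ} (ha : Continuous a) {Φ : X → ℝ → ℝ}
    (hΦ : Continuous fun z : X × ℝ => Φ z.1 z.2) :
    Continuous fun x => ∫ y in (0 : ℝ)..1, c.ρ (a x + y) * Φ x y := by
  rw [continuous_iff_continuousAt]
  intro x₀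
  obtain ⟨K, hK, hKx⟩ := exists_compact_mem_nhds x₀
  obtain ⟨B, hB⟩ := (hK.prod isCompact_Icc (s := K)
    (t := Set.Icc (0 : ℝ) 1)).exists_bound_of_continuousOn hΦ.continuousOn
  obtain ⟨R, hR⟩ := c.exists_bound_density
  have hcont : ∀ x, Continuous (Φ x) := fun x => hΦ.comp (by fun_prop : Continuous fun y => (x, y))
  have hnull : ∀ x, ∀ᵐ y : ℝ, a x + y ∉ c.discSet := by
    intro x
    have h1 : ((fun y => a x + y) ⁻¹' c.discSet).Countable :=
      c.countable_discSet.preimage (add_right_injective _)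
    exact h1.ae_notMem volume
  refine intervalIntegral.continuousAt_of_dominated_interval (bound := fun _ => R * B) ?_ ?_ ?_ ?_
  · refine Eventually.of_forall fun x => AEStronglyMeasurable.mul ?_
      (hcont x).aestronglyMeasurable
    have h1 : ((fun y => a x + y) ⁻¹' c.discSet).Countable :=
      c.countable_discSet.preimage (add_right_injective _)
    refine (aestronglyMeasurable_of_continuousAt_off_countable h1 fun y hy => ?_).restrict
    exact ContinuousAt.comp (f := fun y => a x + y) (g := c.ρ)
      (continuousAt_of_notMem_discSet (y := a x + y) hy).2.2 (by fun_prop)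
  · filter_upwards [hKx] with x hx
    refine ae_of_all _ fun y hy => ?_
    rw [Set.uIoc_of_le zero_le_one] at hy
    rw [norm_mul]
    exact mul_le_mul (hR _) (hB (x, y) ⟨hx, Set.Ioc_subset_Icc_self hy⟩) (norm_nonneg _)
      ((norm_nonneg _).trans (hR 0))
  · exact intervalIntegrable_const
  · filter_upwards [hnull x₀] with y hy _
    refine ContinuousAt.mul ?_ (hΦ.comp (by fun_prop : Continuous fun x => (x, y))).continuousAt
    exact ContinuousAt.comp (f := fun x => a x + y) (g := c.ρ)
      (continuousAt_of_notMem_discSet hy).2.2 (by fun_prop)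

end PeriodicMedium

/-! ### The monodromy matrix and the multiplicities of zeros of its trace function. -/

namespace PeriodicMedium.FundamentalSystem

variable {c : PeriodicMedium} {k : ℝ} (F : c.FundamentalSystem k)

theorem wronskian (lam y : ℝ) : F.C lam y * F.Sv lam y - F.Cv lam y * F.S lam y = 1 := by
  rw [(F.sol_C lam).wronskian_const (F.sol_S lam) 0 y, F.C_zero, F.Cv_zero, F.S_zero, F.Sv_zero]
  ring

theorem eq_comb {lam : ℝ} {u v : ℝ → ℝ} (h : c.IsSolution k lam u v) (y : ℝ) :
    u y = u 0 * F.C lam y + v 0 * F.S lam y ∧ v y = u 0 * F.Cv lam y + v 0 * F.Sv lam y :=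
  h.unique ((F.sol_C lam).lin_comb (F.sol_S lam) (u 0) (v 0)) (a := 0)
    (by simp [F.C_zero, F.S_zero]) (by simp [F.Cv_zero, F.Sv_zero]) y

theorem translate_C (lam y : ℝ) :
    F.C lam (y + 1) = F.C lam 1 * F.C lam y + F.Cv lam 1 * F.S lam y ∧
    F.Cv lam (y + 1) = F.C lam 1 * F.Cv lam y + F.Cv lam 1 * F.Sv lam y := by
  simpa using F.eq_comb (F.sol_C lam).comp_add_one y

theorem translate_S (lam y : ℝ) :
    F.S lam (y + 1) = F.S lam 1 * F.C lam y + F.Sv lam 1 * F.S lam y ∧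
    F.Sv lam (y + 1) = F.S lam 1 * F.Cv lam y + F.Sv lam 1 * F.Sv lam y := by
  simpa using F.eq_comb (F.sol_S lam).comp_add_one y

theorem coeff_eq_zero {lam α β a b : ℝ} (hab : a < b)
    (h : ∀ y ∈ Set.Icc a b, α * F.C lam y + β * F.S lam y = 0) : α = 0 ∧ β = 0 := by
  have h1 := ((F.sol_C lam).lin_comb (F.sol_S lam) α β).eq_zero_of_eqOn hab h 0
  simpa [F.C_zero, F.S_zero, F.Cv_zero, F.Sv_zero] using h1

/-- The trace of the monodromy matrix. -/
def discriminant (lam : ℝ) : ℝ := F.C lam 1 + F.Sv lam 1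

/-- The monodromy matrix at `lam` is `ε` times the identity. -/
def IsScalar (ε lam : ℝ) : Prop :=
  F.C lam 1 = ε ∧ F.S lam 1 = 0 ∧ F.Cv lam 1 = 0 ∧ F.Sv lam 1 = ε

theorem continuous_discriminant : Continuous F.discriminant :=
  (F.cont_C.comp (by fun_prop : Continuous fun l : ℝ => (l, (1 : ℝ)))).add
    (F.cont_Sv.comp (by fun_prop : Continuous fun l : ℝ => (l, (1 : ℝ))))

/-- Both diagonal entries are at least 1. Trace 2 would make 1 a Floquet multiplier, and the
corresponding periodic solution is excluded by the energy identity. -/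
theorem two_lt_discriminant {lam : ℝ} (hlam : lam < 0) : 2 < F.discriminant lam := by
  have h1 := (F.sol_C lam).one_le_fst hlam (F.C_zero lam) (F.Cv_zero lam)
  have h2 := (F.sol_S lam).one_le_snd hlam (F.S_zero lam) (F.Sv_zero lam)
  refine lt_of_le_of_ne (by rw [discriminant]; linarith) fun h => ?_
  rw [discriminant] at h
  obtain ⟨x, y, hxy, e1, e2⟩ := exists_kernel_vector (a := F.C lam 1 - 1) (b := F.S lam 1)
    (c := F.Cv lam 1) (d := F.Sv lam 1 - 1) (by linear_combination h + F.wronskian lam 1)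
  have hs := (F.sol_C lam).lin_comb (F.sol_S lam) x y
  have h3 := hs.eq_zero_of_energy hlam zero_lt_one (by
    simp only [F.C_zero, F.Cv_zero, F.S_zero, F.Sv_zero]
    rw [show x * F.C lam 1 + y * F.S lam 1 = x by linear_combination e1,
      show x * F.Cv lam 1 + y * F.Sv lam 1 = y by linear_combination e2]
    ring) 0
  simp [F.C_zero, F.Cv_zero, F.S_zero, F.Sv_zero] at h3
  simp [h3] at hxy

theorem integral_mul_continuous {u : ℝ → ℝ → ℝ} {w : ℝ → ℝ}
    (hu : Continuous fun z : ℝ × ℝ => u z.1 z.2) (hw : Continuous w) :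
    Continuous fun l => ∫ y in (0 : ℝ)..1, c.ρ y * (u l y * w y) := by
  have h := continuous_integral_density (c := c) (X := ℝ) (a := fun _ => 0) continuous_const
    (Φ := fun l y => u l y * w y) (hu.mul (hw.comp continuous_snd))
  simpa using h

theorem gram_pos (lam : ℝ) : 0 < ∫ y in (0 : ℝ)..1, c.ρ y * (F.C lam y * F.C lam y) ∧
    (∫ y in (0 : ℝ)..1, c.ρ y * (F.C lam y * F.S lam y)) ^ 2 <
      (∫ y in (0 : ℝ)..1, c.ρ y * (F.S lam y * F.S lam y)) *
        ∫ y in (0 : ℝ)..1, c.ρ y * (F.C lam y * F.C lam y) := by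
  have hC := (F.sol_C lam).cont_fst
  have hS := (F.sol_S lam).cont_fst
  have hi : ∀ g : ℝ → ℝ, Continuous g →
      IntervalIntegrable (fun y => c.ρ y * g y) volume 0 1 := fun g hg =>
    (c.intervalIntegrable_density 0 1).mul_continuousOn hg.continuousOn
  have key : ∀ α β : ℝ, (α ≠ 0 ∨ β ≠ 0) →
      0 < α ^ 2 * (∫ y in (0 : ℝ)..1, c.ρ y * (F.C lam y * F.C lam y)) +
        2 * α * β * (∫ y in (0 : ℝ)..1, c.ρ y * (F.C lam y * F.S lam y)) +
        β ^ 2 * ∫ y in (0 : ℝ)..1, c.ρ y * (F.S lam y * F.S lam y) := by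
    intro α β hne
    have hcont : Continuous fun y => α * F.C lam y + β * F.S lam y :=
      (hC.const_mul α).add (hS.const_mul β)
    have hpos : 0 < ∫ y in (0 : ℝ)..1, c.ρ y * (α * F.C lam y + β * F.S lam y) ^ 2 := by
      by_contra hneg
      have := F.coeff_eq_zero zero_lt_one (eq_zero_of_integral_mul_sq_nonpos zero_lt_one c.hρ.pos
        (c.intervalIntegrable_density 0 1) hcont (not_lt.1 hneg))
      simp [this] at hne
    convert hpos using 1
    rw [← intervalIntegral.integral_const_mul, ← intervalIntegral.integral_const_mul,
      ← intervalIntegral.integral_const_mul, ← intervalIntegral.integral_add,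
      ← intervalIntegral.integral_add]
    · refine intervalIntegral.integral_congr fun y _ => ?_
      ring
    · exact ((hi _ (hC.mul hC)).const_mul _).add ((hi _ (hC.mul hS)).const_mul _)
    · exact (hi _ (hS.mul hS)).const_mul _
    · exact (hi _ (hC.mul hC)).const_mul _
    · exact (hi _ (hC.mul hS)).const_mul _
  set γ := ∫ y in (0 : ℝ)..1, c.ρ y * (F.C lam y * F.C lam y)
  set β := ∫ y in (0 : ℝ)..1, c.ρ y * (F.C lam y * F.S lam y)
  set α := ∫ y in (0 : ℝ)..1, c.ρ y * (F.S lam y * F.S lam y)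
  have hγ : 0 < γ := by simpa using key 1 0 (by simp)
  refine ⟨hγ, ?_⟩
  -- Completing the square: at `(-β, γ)` the form equals `γ (α γ - β²)`.
  have h2 := key (-β) γ (Or.inr hγ.ne')
  have h3 : 0 < γ * (α * γ - β ^ 2) := by linear_combination h2
  linarith [(mul_pos_iff_of_pos_left hγ).1 h3]

/-- The value `g l₀` is, up to sign, the integral of `ρ` times a quadratic form in `C`, `S` whose
coefficients are the off-diagonal entries and the difference of the diagonal ones. Trace `2 ε` gives
this form discriminant zero, so it is semidefinite, and the integral can vanish only if the form is
zero, that is, if the matrix is scalar. -/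
theorem exists_discriminant_factor {ε l₀ : ℝ} (hε : ε ^ 2 = 1) (h0 : ε * F.discriminant l₀ = 2)
    (hns : ¬ F.IsScalar ε l₀) : ∃ g : ℝ → ℝ, Continuous g ∧ g l₀ ≠ 0 ∧
      ∀ l, ε * F.discriminant l - 2 = (l - l₀) * g l := by
  have hC := (F.sol_C l₀).cont_fst
  have hS := (F.sol_S l₀).cont_fst
  let A := fun l => ∫ y in (0 : ℝ)..1, c.ρ y * (F.C l y * F.C l₀ y)
  let B := fun l => ∫ y in (0 : ℝ)..1, c.ρ y * (F.C l y * F.S l₀ y)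
  let B' := fun l => ∫ y in (0 : ℝ)..1, c.ρ y * (F.S l y * F.C l₀ y)
  let G := fun l => ∫ y in (0 : ℝ)..1, c.ρ y * (F.S l y * F.S l₀ y)
  have hA : Continuous A := integral_mul_continuous F.cont_C hC
  have hB : Continuous B := integral_mul_continuous F.cont_C hS
  have hB' : Continuous B' := integral_mul_continuous F.cont_S hC
  have hG : Continuous G := integral_mul_continuous F.cont_S hS
  have hBB : B' l₀ = B l₀ := by simp only [B, B', mul_comm (F.S l₀ _)]
  refine ⟨fun l => ε * (F.C l₀ 1 * B l - F.S l₀ 1 * A l + F.Cv l₀ 1 * G l - F.Sv l₀ 1 * B' l),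
    by fun_prop, ?_, fun l => ?_⟩
  · intro h
    simp only [hBB] at h
    obtain ⟨hγ, hdet⟩ := F.gram_pos l₀
    change 0 < A l₀ at hγ
    change B l₀ ^ 2 < G l₀ * A l₀ at hdet
    have hε0 : ε ≠ 0 := by rintro rfl; simp at hε
    replace h := (mul_eq_zero.1 h).resolve_left hε0
    have hw := F.wronskian l₀ 1
    rw [discriminant] at h0
    rw [IsScalar] at hns
    have htr : (F.C l₀ 1 + F.Sv l₀ 1) ^ 2 = 4 := by
      have : (ε * (F.C l₀ 1 + F.Sv l₀ 1)) ^ 2 = 4 := by rw [h0]; norm_num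
      rwa [mul_pow, hε, one_mul] at this
    have htr' : F.C l₀ 1 + F.Sv l₀ 1 = 2 * ε := by
      linear_combination ε * h0 - (F.C l₀ 1 + F.Sv l₀ 1) * hε
    generalize F.C l₀ 1 = p, F.S l₀ 1 = q, F.Cv l₀ 1 = r, F.Sv l₀ 1 = s, A l₀ = a, B l₀ = b,
      G l₀ = d at *
    have hα : 0 < d := (mul_pos_iff_of_pos_right hγ).1 (lt_of_le_of_lt (sq_nonneg b) hdet)
    have hdisc : (p - s) ^ 2 + 4 * q * r = 0 := by linear_combination htr - 4 * hw
    have hsq : (q * a - r * d) ^ 2 = (p - s) ^ 2 * b ^ 2 := by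
      have : q * a - r * d = (p - s) * b := by linear_combination -h
      rw [this]; ring
    -- Otherwise `-4 q r = (p - s)² > 0`, and `(q a - r d)² ≥ -4 q r a d = (p - s)² a d > (p - s)²
    -- b²` contradicts `hsq`.
    have hqr : q * r = 0 := by
      by_contra hne
      have h1 : 0 < (p - s) ^ 2 := by
        refine lt_of_le_of_ne (sq_nonneg _) fun h => hne ?_
        linarith
      nlinarith [sq_nonneg (q * a + r * d), mul_lt_mul_of_pos_left hdet h1]
    have hps : p = s := by
      have : (p - s) ^ 2 = 0 := by linear_combination hdisc - 4 * hqr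
      linarith [pow_eq_zero_iff (two_ne_zero) |>.1 this]
    have hqa : q * a = r * d := by
      subst hps
      linear_combination -h
    have hq0 : q = 0 ∧ r = 0 := by
      rcases mul_eq_zero.1 hqr with h | h
      · refine ⟨h, ?_⟩
        rw [h, zero_mul] at hqa
        exact (mul_eq_zero.1 hqa.symm).resolve_right hα.ne'
      · refine ⟨?_, h⟩
        rw [h, zero_mul] at hqa
        exact (mul_eq_zero.1 hqa).resolve_right hγ.ne'
    exact hns ⟨by linarith, hq0.1, hq0.2, by linarith⟩
  · have e1 := (F.sol_C l).lagrange (F.sol_S l₀) 0 1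
    have e2 := (F.sol_C l).lagrange (F.sol_C l₀) 0 1
    have e3 := (F.sol_S l).lagrange (F.sol_S l₀) 0 1
    have e4 := (F.sol_S l).lagrange (F.sol_C l₀) 0 1
    simp only [F.C_zero, F.Cv_zero, F.S_zero, F.Sv_zero] at e1 e2 e3 e4
    have hw := F.wronskian l₀ 1
    rw [← h0]
    simp only [discriminant, A, B, B', G]
    linear_combination (-ε) * (F.C l₀ 1 * e1 - F.S l₀ 1 * e2 + F.Cv l₀ 1 * e3 - F.Sv l₀ 1 * e4)
      - ε * (F.C l 1 + F.Sv l 1) * hw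

/-- The left side is minus the determinant of the monodromy matrix minus `ε`. At a scalar point the
Lagrange identities give each entry a factor `l - l₀`; what remains at `l₀` is minus the Gram
determinant of `C`, `S`. -/
theorem exists_discriminant_factor_of_isScalar {ε l₀ : ℝ} (hε : ε ^ 2 = 1)
    (hs : F.IsScalar ε l₀) : ∃ g : ℝ → ℝ, Continuous g ∧ g l₀ < 0 ∧
      ∀ l, ε * F.discriminant l - 2 = (l - l₀) ^ 2 * g l := by
  have hC := (F.sol_C l₀).cont_fst
  have hS := (F.sol_S l₀).cont_fst
  let A := fun l => ∫ y in (0 : ℝ)..1, c.ρ y * (F.C l y * F.C l₀ y)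
  let B := fun l => ∫ y in (0 : ℝ)..1, c.ρ y * (F.C l y * F.S l₀ y)
  let B' := fun l => ∫ y in (0 : ℝ)..1, c.ρ y * (F.S l y * F.C l₀ y)
  let G := fun l => ∫ y in (0 : ℝ)..1, c.ρ y * (F.S l y * F.S l₀ y)
  have hA : Continuous A := integral_mul_continuous F.cont_C hC
  have hB : Continuous B := integral_mul_continuous F.cont_C hS
  have hB' : Continuous B' := integral_mul_continuous F.cont_S hC
  have hG : Continuous G := integral_mul_continuous F.cont_S hS
  have hBB : B' l₀ = B l₀ := by simp only [B, B', mul_comm (F.S l₀ _)]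
  refine ⟨fun l => B l * B' l - G l * A l, by fun_prop, ?_, fun l => ?_⟩
  · have := (F.gram_pos l₀).2
    simp only [hBB]
    change B l₀ ^ 2 < G l₀ * A l₀ at this
    linarith
  · have e1 := (F.sol_C l).lagrange (F.sol_S l₀) 0 1
    have e2 := (F.sol_C l).lagrange (F.sol_C l₀) 0 1
    have e3 := (F.sol_S l).lagrange (F.sol_S l₀) 0 1
    have e4 := (F.sol_S l).lagrange (F.sol_C l₀) 0 1
    obtain ⟨s1, s2, s3, s4⟩ := hs
    simp only [F.C_zero, F.Cv_zero, F.S_zero, F.Sv_zero, s1, s2, s3, s4] at e1 e2 e3 e4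
    have hw := F.wronskian l 1
    simp only [discriminant]
    calc ε * (F.C l 1 + F.Sv l 1) - 2 = ((l - l₀) * B l) * ((l - l₀) * B' l) -
        ((l - l₀) * G l) * ((l - l₀) * A l) := by
          simp only [A, B, B', G]
          rw [e1, e2, e3, e4]
          linear_combination hw + (F.C l 1 * F.Sv l 1 - F.Cv l 1 * F.S l 1) * hε
      _ = _ := by ring

/-! ### The Dirichlet function and the simplicity of its zeros. -/

/-- The solution with initial values `(0, 1)` at `a`. -/
def pinned (lam a y : ℝ) : ℝ := F.C lam a * F.S lam y - F.S lam a * F.C lam y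

/-- The quasi-derivative of `pinned`. -/
def pinnedV (lam a y : ℝ) : ℝ := F.C lam a * F.Sv lam y - F.S lam a * F.Cv lam y

/-- Its zeros in `lam` are the Dirichlet eigenvalues on `[a, a + 1]`. -/
def dirichletFun (a lam : ℝ) : ℝ := F.pinned lam a (a + 1)

theorem sol_pinned (lam a : ℝ) : c.IsSolution k lam (F.pinned lam a) (F.pinnedV lam a) := by
  have h := (F.sol_S lam).lin_comb (F.sol_C lam) (F.C lam a) (-F.S lam a)
  simp only [neg_mul, ← sub_eq_add_neg] at h
  exact h

theorem pinned_self (lam a : ℝ) : F.pinned lam a a = 0 := by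
  rw [pinned]; ring

theorem pinnedV_self (lam a : ℝ) : F.pinnedV lam a a = 1 := by
  rw [pinnedV]; linear_combination F.wronskian lam a

theorem continuous_pinned : Continuous fun z : (ℝ × ℝ) × ℝ => F.pinned z.1.1 z.1.2 z.2 := by
  have h1 := F.cont_C
  have h2 := F.cont_S
  exact ((h1.comp continuous_fst).mul (h2.comp (by fun_prop : Continuous fun z : (ℝ × ℝ) × ℝ =>
    (z.1.1, z.2)))).sub ((h2.comp continuous_fst).mul (h1.comp (by fun_prop :
    Continuous fun z : (ℝ × ℝ) × ℝ => (z.1.1, z.2))))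

theorem continuous_dirichletFun : Continuous fun z : ℝ × ℝ => F.dirichletFun z.1 z.2 :=
  F.continuous_pinned.comp (by fun_prop : Continuous fun z : ℝ × ℝ => ((z.2, z.1), z.1 + 1))

theorem dirichletFun_ne_zero {a lam : ℝ} (hlam : lam < 0) : F.dirichletFun a lam ≠ 0 := by
  intro h
  rw [dirichletFun] at h
  have := ((F.sol_pinned lam a).eq_zero_of_energy hlam (lt_add_one a)
    (by rw [h, F.pinned_self]; ring) a).2
  simp [F.pinnedV_self] at this

/-- The inner product of two pinned solutions on `[a, a + 1]`. -/
noncomputable def pinnedInner (a l l' : ℝ) : ℝ :=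
  ∫ y in (0 : ℝ)..1, c.ρ (a + y) * (F.pinned l a (a + y) * F.pinned l' a (a + y))

theorem continuous_pinnedInner :
    Continuous fun z : ℝ × ℝ × ℝ => F.pinnedInner z.1 z.2.1 z.2.2 := by
  refine continuous_integral_density continuous_fst
    (Φ := fun (z : ℝ × ℝ × ℝ) y => F.pinned z.2.1 z.1 (z.1 + y) * F.pinned z.2.2 z.1 (z.1 + y)) ?_
  exact (F.continuous_pinned.comp (by fun_prop : Continuous fun x : (ℝ × ℝ × ℝ) × ℝ =>
    ((x.1.2.1, x.1.1), x.1.1 + x.2))).mul (F.continuous_pinned.comp (by fun_prop :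
    Continuous fun x : (ℝ × ℝ × ℝ) × ℝ => ((x.1.2.2, x.1.1), x.1.1 + x.2)))

theorem pinnedInner_eq (a l l' : ℝ) :
    F.pinnedInner a l l' = ∫ y in a..(a + 1), c.ρ y * (F.pinned l a y * F.pinned l' a y) := by
  rw [pinnedInner, intervalIntegral.integral_comp_add_left
    (fun y => c.ρ y * (F.pinned l a y * F.pinned l' a y)), add_zero]

theorem pinnedInner_pos (a l : ℝ) : 0 < F.pinnedInner a l l := by
  by_contra hneg
  rw [pinnedInner_eq] at hneg
  have h := (F.sol_pinned l a).eq_zero_of_eqOn (lt_add_one a)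
    (eq_zero_of_integral_mul_sq_nonpos (lt_add_one a) c.hρ.pos
    (c.intervalIntegrable_density a (a + 1)) (F.sol_pinned l a).cont_fst
    (by simpa only [sq] using not_lt.1 hneg)) a
  simp [F.pinnedV_self] at h

theorem pinned_lagrange (a l l' : ℝ) : (l - l') * F.pinnedInner a l l' =
    F.dirichletFun a l * F.pinnedV l' a (a + 1) - F.pinnedV l a (a + 1) * F.dirichletFun a l' := by
  rw [pinnedInner_eq, (F.sol_pinned l a).lagrange (F.sol_pinned l' a), F.pinned_self, F.pinned_self,
    dirichletFun, dirichletFun]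
  ring

theorem exists_dirichletFun_factor {a l₀ : ℝ} (h : F.dirichletFun a l₀ = 0) :
    ∃ g : ℝ → ℝ, Continuous g ∧ g l₀ ≠ 0 ∧ ∀ l, F.dirichletFun a l = (l - l₀) * g l := by
  have hv : F.pinnedV l₀ a (a + 1) ≠ 0 := by
    intro hv
    have := ((F.sol_pinned l₀ a).eq_zero (a := a + 1) h hv a).2
    simp [F.pinnedV_self] at this
  refine ⟨fun l => F.pinnedInner a l l₀ / F.pinnedV l₀ a (a + 1), ?_,
    div_ne_zero (F.pinnedInner_pos a l₀).ne' hv, fun l => ?_⟩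
  · exact (F.continuous_pinnedInner.comp (by fun_prop : Continuous fun l : ℝ =>
      (a, l, l₀))).div_const _
  · rw [← mul_div_assoc, F.pinned_lagrange, h, mul_zero, sub_zero, mul_div_cancel_right₀ _ hv]

/-- Pinned solutions at two distinct zeros for the same endpoint are orthogonal with weight `ρ`.
Near `(a, l₀, l₀)` their inner product is close to a positive squared norm, so zeros cannot collide,
uniformly in the endpoint. -/
theorem eventually_dirichletFun_injective (a l₀ : ℝ) :
    ∀ᶠ z : ℝ × ℝ × ℝ in 𝓝 (a, l₀, l₀), F.dirichletFun z.1 z.2.1 = 0 →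
      F.dirichletFun z.1 z.2.2 = 0 → z.2.1 = z.2.2 := by
  have h := F.continuous_pinnedInner.continuousAt.eventually_ne
    (x := (a, l₀, l₀)) (F.pinnedInner_pos a l₀).ne'
  filter_upwards [h] with z hz h1 h2
  have := F.pinned_lagrange z.1 z.2.1 z.2.2
  rw [h1, h2, zero_mul, mul_zero, sub_zero] at this
  exact sub_eq_zero.1 ((mul_eq_zero.1 this).resolve_right hz)

end PeriodicMedium.FundamentalSystem

/-! ### Counting zeros: finiteness, parity and invariance under deformation. -/

/-- The zeros lie in `[0, b]`; an accumulation point would be a zero, yet the factorization isolates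
each zero. -/
theorem finite_zeros_of_factor {f : ℝ → ℝ} (hf : Continuous f) (h0 : ∀ l < 0, f l ≠ 0)
    (hfac : ∀ z, f z = 0 → ∃ m : ℕ, ∃ g : ℝ → ℝ, Continuous g ∧ g z ≠ 0 ∧
      ∀ l, f l = (l - z) ^ m * g l) (b : ℝ) : {z | z < b ∧ f z = 0}.Finite := by
  by_contra hinf
  have hsub : {z | z < b ∧ f z = 0} ⊆ Set.Icc 0 b := fun z hz =>
    ⟨not_lt.1 fun h => h0 z h hz.2, hz.1.le⟩
  obtain ⟨x, -, hacc⟩ := Set.Infinite.exists_accPt_of_subset_isCompact hinf isCompact_Icc hsub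
  rw [accPt_iff_frequently] at hacc
  have hx : f x = 0 := by
    by_contra hne
    obtain ⟨y, hy, hy'⟩ := (hacc.and_eventually (hf.continuousAt.eventually_ne hne)).exists
    exact hy' hy.2.2
  obtain ⟨m, g, hg, hgx, hfg⟩ := hfac x hx
  obtain ⟨y, hy, hy'⟩ := (hacc.and_eventually (hg.continuousAt.eventually_ne hgx)).exists
  have h1 := hy.2.2
  rw [hfg] at h1
  exact mul_ne_zero (pow_ne_zero m (sub_ne_zero.2 hy.1)) hy' h1

/-- The number of zeros of `f` below `b`, counted with multiplicity, is determined modulo two by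
the signs of `f` on the negative half-line and just below `b`. -/
theorem sign_mul_neg_one_pow_sum_multiplicity {f : ℝ → ℝ} (hf : Continuous f) {s b : ℝ}
    (h0 : ∀ l < 0, 0 < s * f l) (hb : ∀ᶠ l in 𝓝[<] b, f l < 0) {m : ℝ → ℕ} {Z : Finset ℝ}
    (hZ : ∀ z, z ∈ Z ↔ z < b ∧ f z = 0)
    (hfac : ∀ z, f z = 0 → ∃ g : ℝ → ℝ, Continuous g ∧ g z ≠ 0 ∧
      ∀ l, f l = (l - z) ^ m z * g l) : s * (-1) ^ (∑ z ∈ Z, m z) ≤ 0 := by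
  by_contra hneg
  push Not at hneg
  have hpc : ∀ Z' : Finset ℝ, Continuous fun l => ∏ z ∈ Z', (l - z) ^ m z := fun Z' => by fun_prop
  -- The product doubles the order of each zero of `f` below `b`, so `h` cannot change sign there.
  -- The sets where `h` is positive, respectively negative, on a punctured neighbourhood are open
  -- and cover the half-line, and connectedness makes them meet if both are nonempty.
  let h := fun l => f l * ∏ z ∈ Z, (l - z) ^ m z
  have hh : Continuous h := hf.mul (hpc Z)
  have hmem : ∀ x, h x ≠ 0 →
      (0 < h x → ∀ᶠ l in 𝓝[≠] x, 0 < h l) ∧ (h x < 0 → ∀ᶠ l in 𝓝[≠] x, h l < 0) := fun x _ =>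
    ⟨fun hx => (hh.continuousAt.eventually_const_lt hx).filter_mono nhdsWithin_le_nhds,
      fun hx => (hh.continuousAt.eventually_lt_const hx).filter_mono nhdsWithin_le_nhds⟩
  have hopen : ∀ p : ℝ → Prop, IsOpen {x : ℝ | ∀ᶠ l in 𝓝[≠] x, p l} := by
    intro p
    rw [isOpen_iff_mem_nhds]
    intro x hx
    rw [Set.mem_ofPred_eq, ← eventually_eventually_nhdsWithin, eventually_nhdsWithin_iff] at hx
    have hx0 : ∀ᶠ l in 𝓝[≠] x, p l := by
      rw [← eventually_eventually_nhdsWithin, eventually_nhdsWithin_iff]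
      exact hx
    filter_upwards [hx] with y hy
    by_cases hyx : y = x
    · rw [hyx]; exact hx0
    · have h1 := hy hyx
      rw [isOpen_compl_singleton.nhdsWithin_eq hyx] at h1
      exact h1.filter_mono nhdsWithin_le_nhds
  have hcover : Set.Iio b ⊆ {x | ∀ᶠ l in 𝓝[≠] x, 0 < h l} ∪ {x | ∀ᶠ l in 𝓝[≠] x, h l < 0} := by
    intro x hx
    by_cases hxZ : x ∈ Z
    · obtain ⟨g, hg, hgx, hfg⟩ := hfac x ((hZ x).1 hxZ).2
      let p := fun l => g l * ∏ z ∈ Z.erase x, (l - z) ^ m z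
      have hp : Continuous p := hg.mul (hpc _)
      have hpx : p x ≠ 0 := mul_ne_zero hgx (Finset.prod_ne_zero_iff.2 fun z hz =>
        pow_ne_zero _ (sub_ne_zero.2 (Finset.ne_of_mem_erase hz).symm))
      have hhp : ∀ l, h l = ((l - x) ^ m x) ^ 2 * p l := by
        intro l
        simp only [h, p]
        rw [← Finset.mul_prod_erase Z _ hxZ, hfg l]
        ring
      have hsq : ∀ l, l ≠ x → 0 < ((l - x) ^ m x) ^ 2 := fun l hl =>
        sq_pos_iff.2 (pow_ne_zero _ (sub_ne_zero.2 hl))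
      rcases hpx.lt_or_gt with hlt | hgt
      · right
        have h1 := hp.continuousAt.eventually_lt_const hlt
        filter_upwards [h1.filter_mono nhdsWithin_le_nhds, self_mem_nhdsWithin] with l hl hne
        rw [hhp]
        exact mul_neg_of_pos_of_neg (hsq l hne) hl
      · left
        have h1 := hp.continuousAt.eventually_const_lt hgt
        filter_upwards [h1.filter_mono nhdsWithin_le_nhds, self_mem_nhdsWithin] with l hl hne
        rw [hhp]
        exact mul_pos (hsq l hne) hl
    · have hfx : f x ≠ 0 := fun h => hxZ ((hZ x).2 ⟨hx, h⟩)
      have hhx : h x ≠ 0 := mul_ne_zero hfx (Finset.prod_ne_zero_iff.2 fun z hz =>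
        pow_ne_zero _ (sub_ne_zero.2 fun h => hxZ (h ▸ hz)))
      rcases hhx.lt_or_gt with hlt | hgt
      · exact Or.inr ((hmem x hhx).2 hlt)
      · exact Or.inl ((hmem x hhx).1 hgt)
  have hleft : ∃ x ∈ Set.Iio b, 0 < h x := by
    refine ⟨min 0 b - 1, by simp only [Set.mem_Iio]; linarith [min_le_right 0 b], ?_⟩
    have hx : min 0 b - 1 < 0 := by linarith [min_le_left 0 b]
    generalize min 0 b - 1 = x at hx
    -- To the left of all zeros every factor is negative, which produces the sign with the total
    -- multiplicity as exponent.
    have h1 : ∏ z ∈ Z, (x - z) ^ m z =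
        (-1) ^ (∑ z ∈ Z, m z) * ∏ z ∈ Z, (z - x) ^ m z := by
      rw [← Finset.prod_pow_eq_pow_sum, ← Finset.prod_mul_distrib]
      refine Finset.prod_congr rfl fun z _ => ?_
      rw [← mul_pow]
      ring
    have h2 : 0 < ∏ z ∈ Z, (z - x) ^ m z := by
      refine Finset.prod_pos fun z hz => pow_pos (sub_pos.2 (hx.trans_le ?_)) _
      refine not_lt.1 fun hz0 => ?_
      have := h0 z hz0
      rw [((hZ z).1 hz).2, mul_zero] at this
      exact this.false
    have h3 := mul_pos (mul_pos (h0 x hx) hneg) h2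
    have hs : 0 < s ^ 2 := by
      refine sq_pos_iff.2 fun hs => ?_
      simp [hs] at hneg
    refine (mul_pos_iff_of_pos_left hs).1 ?_
    simp only [h]
    rw [h1]
    linarith
  have hright : ∃ x ∈ Set.Iio b, h x < 0 := by
    have h1 : ∀ᶠ l in 𝓝[<] b, ∀ z ∈ Z, z < l := by
      rw [Filter.eventually_all_finset]
      intro z hz
      exact (lt_mem_nhds ((hZ z).1 hz).1).filter_mono nhdsWithin_le_nhds
    obtain ⟨x, ⟨hx1, hx2⟩, hx3⟩ := ((hb.and h1).and self_mem_nhdsWithin).exists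
    exact ⟨x, hx3, mul_neg_of_neg_of_pos hx1
      (Finset.prod_pos fun z hz => pow_pos (sub_pos.2 (hx2 z hz)) _)⟩
  obtain ⟨x, hx, hx0⟩ := hleft
  obtain ⟨y, hy, hy0⟩ := hright
  obtain ⟨w, -, hw1, hw2⟩ := isPreconnected_Iio (a := b) _ _ (hopen fun l => 0 < h l)
    (hopen fun l => h l < 0) hcover ⟨x, hx, (hmem x hx0.ne').1 hx0⟩ ⟨y, hy, (hmem y hy0.ne).2 hy0⟩
  rw [Set.mem_ofPred_eq] at hw1 hw2
  obtain ⟨l, hl1, hl2⟩ := (hw1.and hw2).exists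
  exact hl1.not_gt hl2

theorem exists_zero_of_mul_neg {f : ℝ → ℝ} (hf : Continuous f) {p q : ℝ} (hpq : p ≤ q)
    (h : f p * f q < 0) : ∃ l ∈ Set.Icc p q, f l = 0 := by
  rcases mul_neg_iff.1 h with ⟨h1, h2⟩ | ⟨h1, h2⟩
  · exact intermediate_value_Icc' hpq hf.continuousOn ⟨h2.le, h1.le⟩
  · exact intermediate_value_Icc hpq hf.continuousOn ⟨h1.le, h2.le⟩

/-- A simple zero is a sign change, which persists under small changes of `a`. -/
theorem eventually_exists_zero_near {F : ℝ → ℝ → ℝ} (hF : Continuous fun z : ℝ × ℝ => F z.1 z.2)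
    {a₀ z : ℝ} (hfac : ∃ g : ℝ → ℝ, Continuous g ∧ g z ≠ 0 ∧ ∀ l, F a₀ l = (l - z) * g l)
    {r : ℝ} (hr : 0 < r) : ∀ᶠ a in 𝓝 a₀, ∃ l, |l - z| < r ∧ F a l = 0 := by
  obtain ⟨g, hg, hgz, hfg⟩ := hfac
  have h1 : ∀ᶠ l in 𝓝 z, 0 < g z * g l :=
    (hg.const_mul (g z)).continuousAt.eventually_const_lt (mul_self_pos.2 hgz)
  obtain ⟨δ, hδ, h2⟩ := Metric.eventually_nhds_iff.1 h1
  obtain ⟨t, ht0, ht⟩ := exists_between (lt_min hr hδ)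
  have hp := h2 (y := z - t) (by
    rw [Real.dist_eq, sub_sub_cancel_left, abs_neg, abs_of_pos ht0]
    exact ht.trans_le (min_le_right _ _))
  have hq := h2 (y := z + t) (by
    rw [Real.dist_eq, add_sub_cancel_left, abs_of_pos ht0]
    exact ht.trans_le (min_le_right _ _))
  have h3 : F a₀ (z - t) * F a₀ (z + t) < 0 := by
    rw [hfg, hfg]
    have h4 := mul_pos hp hq
    have h5 : 0 < g z ^ 2 := sq_pos_iff.2 hgz
    have h6 : 0 < g (z - t) * g (z + t) := (mul_pos_iff_of_pos_left h5).1 (by linarith)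
    have h7 := mul_pos (mul_pos ht0 ht0) h6
    linarith
  have h4 : Continuous fun a => F a (z - t) * F a (z + t) :=
    (hF.comp (by fun_prop : Continuous fun a => (a, z - t))).mul
      (hF.comp (by fun_prop : Continuous fun a => (a, z + t)))
  filter_upwards [h4.continuousAt.eventually_lt_const h3] with a ha
  obtain ⟨l, hl, hl0⟩ := exists_zero_of_mul_neg
    (hF.comp (by fun_prop : Continuous fun l => (a, l))) (by linarith) ha
  refine ⟨l, lt_of_le_of_lt (abs_le.2 ⟨?_, ?_⟩) (ht.trans_le (min_le_left _ _)), hl0⟩ <;>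
  linarith [hl.1, hl.2]

/-- The count is locally constant in `a`. Zeros below `b` are confined to `[0, b]`, persist and do
not split. None can enter or leave through `b`, since `b` is always a zero and `hinj` at `b` forbids
a second one nearby. -/
theorem ncard_zeros_eq {F : ℝ → ℝ → ℝ} (hF : Continuous fun z : ℝ × ℝ => F z.1 z.2)
    (h0 : ∀ a, ∀ l < 0, F a l ≠ 0) {b : ℝ} (hb : ∀ a, F a b = 0)
    (hfac : ∀ a z, F a z = 0 →
      ∃ g : ℝ → ℝ, Continuous g ∧ g z ≠ 0 ∧ ∀ l, F a l = (l - z) * g l)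
    (hinj : ∀ a z, ∀ᶠ w : ℝ × ℝ × ℝ in 𝓝 (a, z, z), F w.1 w.2.1 = 0 → F w.1 w.2.2 = 0 →
      w.2.1 = w.2.2) (a a' : ℝ) :
    {l | l < b ∧ F a l = 0}.ncard = {l | l < b ∧ F a' l = 0}.ncard := by
  have hloc : IsLocallyConstant fun a => {l | l < b ∧ F a l = 0}.ncard := by
    rw [IsLocallyConstant.iff_eventually_eq]
    intro a₀
    have hfin : {l | l < b ∧ F a₀ l = 0}.Finite :=
      finite_zeros_of_factor (hF.comp (by fun_prop : Continuous fun l => (a₀, l))) (h0 a₀)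
        (fun z hz => ⟨1, by simpa using hfac a₀ z hz⟩) b
    set Z := {l | l < b ∧ F a₀ l = 0} with hZ
    have hinj' : ∀ z, ∀ᶠ r : ℝ in 𝓝[>] 0, ∀ᶠ a in 𝓝 a₀, ∀ l l', |l - z| < r → |l' - z| < r →
        F a l = 0 → F a l' = 0 → l = l' := by
      intro z
      obtain ⟨δ, hδ, h⟩ := Metric.eventually_nhds_iff.1 (hinj a₀ z)
      filter_upwards [Ioo_mem_nhdsGT hδ] with r hr
      filter_upwards [Metric.ball_mem_nhds a₀ hδ] with a ha l l' hl hl' e e'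
      refine h (y := (a, l, l')) ?_ e e'
      simp only [Prod.dist_eq, Real.dist_eq]
      exact max_lt ha (max_lt (hl.trans hr.2) (hl'.trans hr.2))
    have hsep : ∀ᶠ r : ℝ in 𝓝[>] 0, ∀ z ∈ Z, ∀ z' ∈ Z, |z - z'| < 2 * r → z = z' := by
      rw [Filter.eventually_all_finite hfin]
      intro z _
      rw [Filter.eventually_all_finite hfin]
      intro z' _
      by_cases hzz : z = z'
      · exact Eventually.of_forall fun _ _ => hzz
      · filter_upwards [Ioo_mem_nhdsGT (half_pos (abs_pos.2 (sub_ne_zero.2 hzz)))] with r hr h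
        linarith [hr.2]
    have hlt : ∀ᶠ r : ℝ in 𝓝[>] 0, ∀ z ∈ Z, z + r < b := by
      rw [Filter.eventually_all_finite hfin]
      intro z hz
      filter_upwards [Ioo_mem_nhdsGT (sub_pos.2 hz.1)] with r hr
      linarith [hr.2]
    have hinjZ := (Filter.eventually_all_finite hfin).2 fun z _ => hinj' z
    obtain ⟨r, ⟨⟨hr1, hr2⟩, hr3⟩, hr0⟩ :=
      (((hsep.and hlt).and hinjZ).and self_mem_nhdsWithin).exists
    have hex := (Filter.eventually_all_finite hfin).2 fun z hz =>
      eventually_exists_zero_near hF (hfac a₀ z hz.2) hr0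
    -- Compactness of `[0, b]`: no zero appears away from `Z`, the endpoint `b` being covered by the
    -- uniqueness of zeros near it.
    have hall : ∀ᶠ a in 𝓝 a₀, ∀ l ∈ Set.Icc 0 b, F a l = 0 → l < b → ∃ z ∈ Z, |l - z| < r := by
      refine isCompact_Icc.eventually_forall_of_forall_eventually fun x hx => ?_
      by_cases hx0 : F a₀ x = 0
      · rcases hx.2.lt_or_eq with hxb | hxb
        · have h1 : ∀ᶠ w : ℝ × ℝ in 𝓝 (a₀, x), |w.2 - x| < r :=
            (by fun_prop : Continuous fun w : ℝ × ℝ => |w.2 - x|).continuousAt.eventually_lt_const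
              (by simpa using hr0)
          filter_upwards [h1] with w hw _ _
          exact ⟨x, ⟨hxb, hx0⟩, hw⟩
        · have h1 : Tendsto (fun w : ℝ × ℝ => (w.1, w.2, b)) (𝓝 (a₀, x)) (𝓝 (a₀, b, b)) := by
            have := (by fun_prop : Continuous fun w : ℝ × ℝ => (w.1, w.2, b)).tendsto (a₀, x)
            rwa [hxb] at this ⊢
          filter_upwards [h1.eventually (hinj a₀ b)] with w hw e hlt
          exact absurd (hw e (hb _)) hlt.ne
      · have h1 := hF.continuousAt.eventually_ne (x := (a₀, x)) hx0
        filter_upwards [h1] with w hw e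
        exact absurd e hw
    filter_upwards [(Filter.eventually_all_finite hfin).2 hr3, hex, hall] with a ha1 ha2 ha3
    have ha3' : ∀ l ∈ {l | l < b ∧ F a l = 0}, ∃ z ∈ Z, |l - z| < r := fun l hl =>
      ha3 l ⟨not_lt.1 fun h => h0 a l h hl.2, hl.1.le⟩ hl.2 hl.1
    choose! φ hφZ hφr using ha3'
    -- Sending a zero to a member of `Z` within `r` is injective by `ha1`; it is onto by `ha2` and
    -- the `2 * r` separation.
    refine Set.ncard_congr (fun l _ => φ l) hφZ ?_ ?_
    · intro l l' hl hl' he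
      exact ha1 (φ l) (hφZ l hl) l l' (hφr l hl) (he ▸ hφr l' hl') hl.2 hl'.2
    · intro z hz
      obtain ⟨l, hl, hl0⟩ := ha2 z hz
      have hlb : l < b := by linarith [hr2 z hz, (abs_lt.1 hl).2]
      refine ⟨l, ⟨hlb, hl0⟩, (hr1 z hz _ (hφZ l ⟨hlb, hl0⟩) ?_).symm⟩
      have h1 := hφr l ⟨hlb, hl0⟩
      calc |z - φ l| = |(l - φ l) - (l - z)| := by congr 1; ring
        _ ≤ |l - φ l| + |l - z| := abs_sub _ _
        _ < 2 * r := by linarith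
  exact hloc.apply_eq_of_preconnectedSpace a a'

/-! ### Absolute continuity, kernels of two by two systems and dimension counts. -/

theorem AbsolutelyContinuousOnInterval.ae_differentiableAt_complex {f : ℝ → ℂ} {a b : ℝ}
    (hf : AbsolutelyContinuousOnInterval f a b) :
    ∀ᵐ x : ℝ, x ∈ Set.uIcc a b → DifferentiableAt ℝ f x :=
  hf.boundedVariationOn.ae_differentiableAt_of_mem_uIcc

theorem AbsolutelyContinuousOnInterval.ofReal {f : ℝ → ℝ} {a b : ℝ}
    (hf : AbsolutelyContinuousOnInterval f a b) :
    AbsolutelyContinuousOnInterval (fun y => (f y : ℂ)) a b := by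
  rw [absolutelyContinuousOnInterval_iff] at hf ⊢
  simpa only [Complex.isometry_ofReal.dist_eq] using hf

theorem AbsolutelyContinuousOnInterval.mul_complex {f g : ℝ → ℂ} {a b : ℝ}
    (hf : AbsolutelyContinuousOnInterval f a b) (hg : AbsolutelyContinuousOnInterval g a b) :
    AbsolutelyContinuousOnInterval (fun y => f y * g y) a b :=
  hf.smul hg

theorem eq_zero_on_Icc_of_off_countable {f : ℝ → ℂ} {S : Set ℝ} (hS : S.Countable)
    (hf : Continuous f) {a b : ℝ} (hab : a < b) (h : ∀ y ∈ Set.Ioo a b, y ∉ S → f y = 0) :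
    ∀ y ∈ Set.Icc a b, f y = 0 := by
  refine Measure.eqOn_Icc_of_ae_eq volume hab.ne (g := fun _ => 0) ?_ hf.continuousOn
    continuousOn_const
  rw [← Measure.restrict_congr_set Ioo_ae_eq_Icc]
  filter_upwards [ae_restrict_mem measurableSet_Ioo, ae_restrict_of_ae (hS.ae_notMem volume)]
    with y hy hyS using h y hy hyS

/-- The solution space of a homogeneous two by two system with real coefficients. -/
noncomputable def kernelPlane (a b c d : ℝ) : Submodule ℂ (ℂ × ℂ) :=
  LinearMap.ker ((((a : ℂ) • LinearMap.fst ℂ ℂ ℂ + (b : ℂ) • LinearMap.snd ℂ ℂ ℂ).prod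
    ((c : ℂ) • LinearMap.fst ℂ ℂ ℂ + (d : ℂ) • LinearMap.snd ℂ ℂ ℂ)))

theorem mem_kernelPlane {a b c d : ℝ} {x : ℂ × ℂ} : x ∈ kernelPlane a b c d ↔
    a * x.1 + b * x.2 = 0 ∧ c * x.1 + d * x.2 = 0 := by
  simp [kernelPlane]

theorem finrank_kernelPlane_eq_zero {a b c d : ℝ} (h : a * d - b * c ≠ 0) :
    Module.finrank ℂ (kernelPlane a b c d) = 0 := by
  rw [Submodule.finrank_eq_zero, Submodule.eq_bot_iff]
  rintro ⟨x, y⟩ hx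
  obtain ⟨h1, h2⟩ := mem_kernelPlane.1 hx
  simp only at h1 h2
  have h' : (a * d - b * c : ℂ) ≠ 0 := by exact_mod_cast h
  have hx0 : (a * d - b * c : ℂ) * x = 0 := by linear_combination d * h1 - b * h2
  have hy0 : (a * d - b * c : ℂ) * y = 0 := by linear_combination a * h2 - c * h1
  simp [(mul_eq_zero.1 hx0).resolve_left h', (mul_eq_zero.1 hy0).resolve_left h']

theorem one_le_finrank_kernelPlane {a b c d : ℝ} (h : a * d - b * c = 0) :
    1 ≤ Module.finrank ℂ (kernelPlane a b c d) := by
  rw [Submodule.one_le_finrank_iff, Ne, Submodule.eq_bot_iff]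
  intro hall
  obtain ⟨x, y, hxy, h1, h2⟩ := exists_kernel_vector (a := (a : ℂ)) (b := b) (c := c) (d := d)
    (by exact_mod_cast h)
  have := hall (x, y) (mem_kernelPlane.2 ⟨h1, h2⟩)
  simp only [Prod.mk_eq_zero] at this
  simp [this] at hxy

theorem two_le_finrank_kernelPlane_iff {a b c d : ℝ} :
    2 ≤ Module.finrank ℂ (kernelPlane a b c d) ↔ a = 0 ∧ b = 0 ∧ c = 0 ∧ d = 0 := by
  have h2 : Module.finrank ℂ (ℂ × ℂ) = 2 := by simp
  constructor
  · intro h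
    have htop : kernelPlane a b c d = ⊤ :=
      Submodule.eq_top_of_finrank_eq (le_antisymm (Submodule.finrank_le _) (by rw [h2]; exact h))
    have e1 : ((1 : ℂ), (0 : ℂ)) ∈ kernelPlane a b c d := htop ▸ Submodule.mem_top
    have e2 : ((0 : ℂ), (1 : ℂ)) ∈ kernelPlane a b c d := htop ▸ Submodule.mem_top
    rw [mem_kernelPlane] at e1 e2
    simp at e1 e2
    exact ⟨e1.1, e2.1, e1.2, e2.2⟩
  · rintro ⟨rfl, rfl, rfl, rfl⟩
    have htop : kernelPlane 0 0 0 0 = ⊤ := by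
      rw [eq_top_iff]
      intro x _
      rw [mem_kernelPlane]
      simp
    rw [htop, finrank_top, h2]

theorem finrank_kernelPlane_le_two {a b c d : ℝ} :
    Module.finrank ℂ (kernelPlane a b c d) ≤ 2 := by
  have h := Submodule.finrank_le (kernelPlane a b c d)
  simpa using h

theorem rank_biSup_eq_sum {V : Type*} [AddCommGroup V] [Module ℂ V] {E : ℝ → Submodule ℂ V}
    (hE : iSupIndep E) {d : ℝ → ℕ} (hd : ∀ ν, Module.rank ℂ (E ν) = d ν) {I : Set ℝ}
    {Z : Finset ℝ} (hZI : ∀ ν ∈ Z, ν ∈ I) (hIZ : ∀ ν ∈ I, d ν ≠ 0 → ν ∈ Z) :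
    Module.rank ℂ (⨆ ν ∈ I, E ν : Submodule ℂ V) = (∑ ν ∈ Z, d ν : ℕ) := by
  have h1 : (⨆ ν ∈ I, E ν) = ⨆ ν ∈ Z, E ν := by
    apply le_antisymm
    · refine iSup₂_le fun ν hν => ?_
      by_cases h0 : d ν = 0
      · have : E ν = ⊥ := by
          rw [← Submodule.rank_eq_zero, hd, h0, Nat.cast_zero]
        rw [this]
        exact bot_le
      · exact le_iSup₂ (f := fun ν (_ : ν ∈ Z) => E ν) ν (hIZ ν hν h0)
    · exact iSup₂_le fun ν hν => le_iSup₂ (f := fun ν (_ : ν ∈ I) => E ν) ν (hZI ν hν)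
  rw [h1]
  clear h1 hZI hIZ
  induction Z using Finset.induction_on with
  | empty => simp
  | insert ν Z hν ih =>
    have hdis : Disjoint (E ν) (⨆ i ∈ Z, E i) :=
      hE.disjoint_biSup (y := (Z : Set ℝ)) (by simpa using hν)
    have h2 := Submodule.rank_sup_add_rank_inf_eq (E ν) (⨆ i ∈ Z, E i)
    rw [hdis.eq_bot, rank_bot, add_zero] at h2
    rw [Finset.iSup_insert, h2, hd, ih, Finset.sum_insert hν, Nat.cast_add]

/-! ### Eigenfunctions as combinations of the fundamental system. -/

namespace PeriodicMedium

variable {c : PeriodicMedium} {k lam : ℝ} {u v : ℝ → ℝ}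

theorem absolutelyContinuous_of_deriv {f g : ℝ → ℝ} (hf : Continuous f)
    (hd : ∀ y ∉ c.discSet, HasDerivAt f (g y) y) (hg : ∀ a b, IntervalIntegrable g volume a b)
    (a b : ℝ) : AbsolutelyContinuousOnInterval f a b := by
  have h : f = fun y => (∫ s in a..y, g s) - (fun _ => -f a) y := by
    funext y
    have := integral_eq_of_hasDerivAt_off_countable f g (a := a) (b := y) c.countable_discSet
      hf.continuousOn (fun y hy => hd y hy.2) (hg a y)
    simp only [this]
    ring
  rw [h]
  refine ((hg a b).absolutelyContinuousOnInterval_intervalIntegral (by simp)).sub ?_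
  exact (LipschitzWith.const (-f a)).lipschitzOnWith.absolutelyContinuousOnInterval

theorem IsSolution.absolutelyContinuous (h : c.IsSolution k lam u v) (a b : ℝ) :
    AbsolutelyContinuousOnInterval (fun y => (u y : ℂ)) a b ∧
    AbsolutelyContinuousOnInterval (fun y => (v y : ℂ)) a b :=
  ⟨(absolutelyContinuous_of_deriv h.cont_fst h.deriv_fst (fun a b =>
      (c.intervalIntegrable_inv a b).mul_continuousOn h.cont_snd.continuousOn) a b).ofReal,
    (absolutelyContinuous_of_deriv h.cont_snd h.deriv_snd (fun a b =>
      (c.intervalIntegrable_potential k lam a b).mul_continuousOn h.cont_fst.continuousOn)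
      a b).ofReal⟩

/-- The Wronskian is absolutely continuous with derivative zero almost everywhere; this carries
uniqueness over to solutions in the almost everywhere sense. -/
theorem IsSolution.wronskian_complex (h : c.IsSolution k lam u v) {a : ℝ} {f g : ℝ → ℂ}
    (hfg : c.InDomain a f g)
    (he : ∀ᵐ y ∂(volume.restrict (Set.Icc a (a + 1))), c.opA k f g y = (lam : ℂ) * f y) :
    ∃ κ : ℂ, ∀ y ∈ Set.Icc a (a + 1), f y * v y - g y * u y = κ := by
  obtain ⟨hf, hg, hv⟩ := hfg
  have hle : a ≤ a + 1 := by linarith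
  have hI : Set.uIcc a (a + 1) = Set.Icc a (a + 1) := Set.uIcc_of_le hle
  obtain ⟨hu, hv'⟩ := h.absolutelyContinuous a (a + 1)
  have hac := (hf.mul_complex hv').sub (hg.mul_complex hu)
  rw [← hI]
  refine hac.const_of_ae_hasDerivAt_zero ?_
  rw [ae_restrict_iff' measurableSet_Icc] at hv he
  filter_upwards [hf.ae_differentiableAt_complex, hg.ae_differentiableAt_complex, hv, he,
    c.countable_discSet.ae_notMem volume] with y h1 h2 h3 h4 h5 hy
  have d1 := (h1 hy).hasDerivAt
  have d2 := (h2 hy).hasDerivAt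
  rw [hI] at hy
  have e3 := h3 hy
  have e4 := h4 hy
  rw [opA] at e4
  have hμ : (c.μ₁ y : ℂ) ≠ 0 := by exact_mod_cast (c.hμ₁.pos y).ne'
  have hρ : (c.ρ y : ℂ) ≠ 0 := by exact_mod_cast (c.hρ.pos y).ne'
  refine ((d1.mul (h.deriv_snd y h5).ofReal_comp).sub
    (d2.mul (h.deriv_fst y h5).ofReal_comp)).congr_deriv ?_
  have e5 : deriv g y = ((k : ℂ) ^ 2 * c.μ₂ y - lam * c.ρ y) * f y := by
    field_simp at e4
    linear_combination -e4
  rw [e3, e5]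
  simp only [potential]
  push_cast
  field_simp
  ring

namespace FundamentalSystem

variable (F : c.FundamentalSystem k)

/-- The solution with complex coefficients `x` with respect to the fundamental system, and its
quasi-derivative. -/
noncomputable def comb (ν : ℝ) (x : ℂ × ℂ) (y : ℝ) : ℂ := x.1 * F.C ν y + x.2 * F.S ν y

/-- The quasi-derivative of `comb`. -/
noncomputable def combV (ν : ℝ) (x : ℂ × ℂ) (y : ℝ) : ℂ := x.1 * F.Cv ν y + x.2 * F.Sv ν y

theorem continuous_comb (ν : ℝ) (x : ℂ × ℂ) : Continuous (F.comb ν x) := by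
  have h1 := (F.sol_C ν).cont_fst
  have h2 := (F.sol_S ν).cont_fst
  unfold comb
  fun_prop

theorem continuous_combV (ν : ℝ) (x : ℂ × ℂ) : Continuous (F.combV ν x) := by
  have h1 := (F.sol_C ν).cont_snd
  have h2 := (F.sol_S ν).cont_snd
  unfold combV
  fun_prop

theorem deriv_comb (ν : ℝ) (x : ℂ × ℂ) {y : ℝ} (hy : y ∉ c.discSet) :
    HasDerivAt (F.comb ν x) ((c.μ₁ y : ℂ)⁻¹ * F.combV ν x y) y := by
  refine ((((F.sol_C ν).deriv_fst y hy).ofReal_comp.const_mul x.1).add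
    (((F.sol_S ν).deriv_fst y hy).ofReal_comp.const_mul x.2)).congr_deriv ?_
  simp only [combV]
  push_cast
  ring

theorem deriv_combV (ν : ℝ) (x : ℂ × ℂ) {y : ℝ} (hy : y ∉ c.discSet) :
    HasDerivAt (F.combV ν x) (((k : ℂ) ^ 2 * c.μ₂ y - ν * c.ρ y) * F.comb ν x y) y := by
  refine ((((F.sol_C ν).deriv_snd y hy).ofReal_comp.const_mul x.1).add
    (((F.sol_S ν).deriv_snd y hy).ofReal_comp.const_mul x.2)).congr_deriv ?_
  simp only [comb, potential]
  push_cast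
  ring

theorem inDomain_comb (ν : ℝ) (x : ℂ × ℂ) (a : ℝ) : c.InDomain a (F.comb ν x) (F.combV ν x) := by
  obtain ⟨h1, h2⟩ := (F.sol_C ν).absolutelyContinuous a (a + 1)
  obtain ⟨h3, h4⟩ := (F.sol_S ν).absolutelyContinuous a (a + 1)
  refine ⟨(h1.const_smul x.1).add (h3.const_smul x.2), (h2.const_smul x.1).add (h4.const_smul x.2),
    ae_restrict_of_ae ?_⟩
  filter_upwards [c.countable_discSet.ae_notMem volume] with y hy
  have hμ : (c.μ₁ y : ℂ) ≠ 0 := by exact_mod_cast (c.hμ₁.pos y).ne'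
  rw [(F.deriv_comb ν x hy).deriv]
  field_simp

theorem opA_comb (ν : ℝ) (x : ℂ × ℂ) (a : ℝ) : ∀ᵐ y ∂(volume.restrict (Set.Icc a (a + 1))),
    c.opA k (F.comb ν x) (F.combV ν x) y = (ν : ℂ) * F.comb ν x y := by
  refine ae_restrict_of_ae ?_
  filter_upwards [c.countable_discSet.ae_notMem volume] with y hy
  have hρ : (c.ρ y : ℂ) ≠ 0 := by exact_mod_cast (c.hρ.pos y).ne'
  rw [opA, (F.deriv_combV ν x hy).deriv]
  field_simp
  ring

theorem exists_eq_comb {ν a : ℝ} {f g : ℝ → ℂ} (hfg : c.InDomain a f g)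
    (he : ∀ᵐ y ∂(volume.restrict (Set.Icc a (a + 1))), c.opA k f g y = (ν : ℂ) * f y) :
    ∃ x : ℂ × ℂ, ∀ y ∈ Set.Icc a (a + 1), f y = F.comb ν x y ∧ g y = F.combV ν x y := by
  obtain ⟨κ, hκ⟩ := (F.sol_S ν).wronskian_complex hfg he
  obtain ⟨κ', hκ'⟩ := (F.sol_C ν).wronskian_complex hfg he
  -- Cramer's rule: the constant Wronskians with `S` and `C` are the coefficients, up to sign.
  refine ⟨(κ, -κ'), fun y hy => ?_⟩
  have hw : (F.C ν y * F.Sv ν y - F.Cv ν y * F.S ν y : ℂ) = 1 := by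
    exact_mod_cast F.wronskian ν y
  simp only [comb, combV, ← hκ y hy, ← hκ' y hy]
  constructor
  · linear_combination (-f y) * hw
  · linear_combination (-g y) * hw

/-- The restrictions to `[a, a + 1]` of the solutions. -/
noncomputable def combMap (a ν : ℝ) : (ℂ × ℂ) →ₗ[ℂ] (Set.Icc a (a + 1) → ℂ) where
  toFun x := (Set.Icc a (a + 1)).domRestrict (F.comb ν x)
  map_add' x x' := by
    funext y
    simp only [Set.domRestrict_apply, comb, Pi.add_apply, Prod.fst_add, Prod.snd_add]
    ring
  map_smul' r x := by
    funext y
    simp only [Set.domRestrict_apply, comb, Pi.smul_apply, Prod.smul_fst, Prod.smul_snd,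
      smul_eq_mul, RingHom.id_apply]
    ring

theorem combMap_apply (a ν : ℝ) (x : ℂ × ℂ) (y : Set.Icc a (a + 1)) :
    F.combMap a ν x y = F.comb ν x y := rfl

theorem combMap_injective (a ν : ℝ) : Function.Injective (F.combMap a ν) := by
  rw [← LinearMap.ker_eq_bot, LinearMap.ker_eq_bot']
  intro x hx
  have h : ∀ y ∈ Set.Icc a (a + 1), F.comb ν x y = 0 := fun y hy => congrFun hx ⟨y, hy⟩
  have hre := F.coeff_eq_zero (lam := ν) (α := x.1.re) (β := x.2.re) (lt_add_one a) fun y hy => by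
    simpa [comb] using congrArg Complex.re (h y hy)
  have him := F.coeff_eq_zero (lam := ν) (α := x.1.im) (β := x.2.im) (lt_add_one a) fun y hy => by
    simpa [comb] using congrArg Complex.im (h y hy)
  exact Prod.ext (Complex.ext hre.1 him.1) (Complex.ext hre.2 him.2)

/-- An eigenfunction agrees with a combination only on `[a, a + 1]`, so `hbc` asks that the boundary
condition see nothing else. -/
theorem eigenfunctions_eq {a ν : ℝ} {bc : (ℝ → ℂ) → (ℝ → ℂ) → Prop} {K : Submodule ℂ (ℂ × ℂ)}
    (hbc : ∀ u v u' v' : ℝ → ℂ, (∀ y ∈ Set.Icc a (a + 1), u y = u' y ∧ v y = v' y) →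
      bc u v → bc u' v')
    (hK : ∀ x, x ∈ K ↔ bc (F.comb ν x) (F.combV ν x)) :
    c.eigenfunctions k a bc ν = (K.map (F.combMap a ν) : Set (Set.Icc a (a + 1) → ℂ)) := by
  ext f
  constructor
  · rintro ⟨u, v, hd, hb, he, rfl⟩
    obtain ⟨x, hx⟩ := F.exists_eq_comb hd he
    refine ⟨x, (hK x).2 (hbc _ _ _ _ hx hb), ?_⟩
    funext y
    exact (hx y y.2).1.symm
  · rintro ⟨x, hx, rfl⟩
    exact ⟨_, _, F.inDomain_comb ν x a, (hK x).1 hx, F.opA_comb ν x a, rfl⟩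

/-- Differentiating the vanishing sum twice off the discontinuities amounts to applying the
operator, which multiplies each term by its eigenvalue. -/
theorem sum_mul_comb_eq_zero {a b : ℝ} (hab : a < b) (s : Finset ℝ) (x : ℝ → ℂ × ℂ)
    (h : ∀ y ∈ Set.Icc a b, ∑ ν ∈ s, F.comb ν (x ν) y = 0) :
    ∀ y ∈ Set.Icc a b, ∑ ν ∈ s, (ν : ℂ) * F.comb ν (x ν) y = 0 := by
  have hcu : Continuous fun y => ∑ ν ∈ s, (ν : ℂ) * F.comb ν (x ν) y :=
    continuous_finsetSum _ fun ν _ => (F.continuous_comb ν (x ν)).const_mul _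
  have hcv : Continuous fun y => ∑ ν ∈ s, F.combV ν (x ν) y :=
    continuous_finsetSum _ fun ν _ => F.continuous_combV ν (x ν)
  have hloc : ∀ {f : ℝ → ℂ} {f' : ℂ} {y : ℝ}, (∀ y ∈ Set.Icc a b, f y = 0) → y ∈ Set.Ioo a b →
      HasDerivAt f f' y → f' = 0 := by
    intro f f' y hf hy hd
    refine hd.unique ((hasDerivAt_const y (0 : ℂ)).congr_of_eventuallyEq ?_)
    filter_upwards [Icc_mem_nhds hy.1 hy.2] with z hz using hf z hz
  have hv : ∀ y ∈ Set.Icc a b, ∑ ν ∈ s, F.combV ν (x ν) y = 0 := by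
    refine eq_zero_on_Icc_of_off_countable c.countable_discSet hcv hab fun y hy hyS => ?_
    have h1 := hloc h hy (HasDerivAt.fun_sum fun ν _ => F.deriv_comb ν (x ν) hyS)
    rw [← Finset.mul_sum] at h1
    have hμ : (c.μ₁ y : ℂ) ≠ 0 := by exact_mod_cast (c.hμ₁.pos y).ne'
    exact (mul_eq_zero.1 h1).resolve_left (inv_ne_zero hμ)
  refine eq_zero_on_Icc_of_off_countable c.countable_discSet hcu hab fun y hy hyS => ?_
  have h1 := hloc hv hy (HasDerivAt.fun_sum fun ν _ => F.deriv_combV ν (x ν) hyS)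
  have h2 := h y (Set.Ioo_subset_Icc_self hy)
  have hρ : (c.ρ y : ℂ) ≠ 0 := by exact_mod_cast (c.hρ.pos y).ne'
  refine (mul_eq_zero.1 (?_ : (c.ρ y : ℂ) * _ = 0)).resolve_left hρ
  rw [Finset.mul_sum]
  have h3 : ∑ ν ∈ s, (c.ρ y : ℂ) * ((ν : ℂ) * F.comb ν (x ν) y) =
      (k : ℂ) ^ 2 * c.μ₂ y * ∑ ν ∈ s, F.comb ν (x ν) y -
        ∑ ν ∈ s, ((k : ℂ) ^ 2 * c.μ₂ y - ν * c.ρ y) * F.comb ν (x ν) y := by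
    rw [Finset.mul_sum, ← Finset.sum_sub_distrib]
    exact Finset.sum_congr rfl fun ν _ => by ring
  rw [h3, h1, h2]
  simp

theorem comb_eq_zero_of_sum_eq_zero {a b : ℝ} (hab : a < b) (s : Finset ℝ) (x : ℝ → ℂ × ℂ)
    (h : ∀ y ∈ Set.Icc a b, ∑ ν ∈ s, F.comb ν (x ν) y = 0) :
    ∀ ν ∈ s, ∀ y ∈ Set.Icc a b, F.comb ν (x ν) y = 0 := by
  induction s using Finset.induction_on generalizing x with
  | empty => simp
  | insert μ s hμ ih =>
    have h1 := F.sum_mul_comb_eq_zero hab _ x h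
    have h2 := ih (fun ν => ((ν : ℂ) - μ) • x ν) fun y hy => by
      have e1 := h y hy
      have e2 := h1 y hy
      rw [Finset.sum_insert hμ] at e1 e2
      have e3 : ∑ ν ∈ s, F.comb ν (((ν : ℂ) - μ) • x ν) y =
          ∑ ν ∈ s, (ν : ℂ) * F.comb ν (x ν) y - μ * ∑ ν ∈ s, F.comb ν (x ν) y := by
        rw [Finset.mul_sum, ← Finset.sum_sub_distrib]
        refine Finset.sum_congr rfl fun ν _ => ?_
        simp only [comb, Prod.smul_fst, Prod.smul_snd, smul_eq_mul]
        ring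
      rw [e3]
      linear_combination e2 - μ * e1
    have h3 : ∀ ν ∈ s, ∀ y ∈ Set.Icc a b, F.comb ν (x ν) y = 0 := by
      intro ν hν y hy
      have hne : (ν : ℂ) - μ ≠ 0 := by
        rw [sub_ne_zero]
        exact fun he => hμ (Complex.ofReal_injective he ▸ hν)
      refine (mul_eq_zero.1 ((?_ : ((ν : ℂ) - μ) * F.comb ν (x ν) y = 0))).resolve_left hne
      rw [← h2 ν hν y hy]
      simp only [comb, Prod.smul_fst, Prod.smul_snd, smul_eq_mul]
      ring
    intro ν hν y hy
    rcases Finset.mem_insert.1 hν with rfl | hν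
    · have := h y hy
      rw [Finset.sum_insert hμ, Finset.sum_eq_zero fun ν hν => h3 ν hν y hy, add_zero] at this
      exact this
    · exact h3 ν hν y hy

theorem iSupIndep_map (a : ℝ) (K : ℝ → Submodule ℂ (ℂ × ℂ)) :
    iSupIndep fun ν => (K ν).map (F.combMap a ν) := by
  rw [iSupIndep_iff_finsetSum_eq_zero_imp_eq_zero]
  intro s f hf hsum
  have hx : ∀ ν ∈ s, ∃ x : ℂ × ℂ, F.combMap a ν x = f ν := fun ν hν => by
    obtain ⟨x, -, hx⟩ := hf ν hν
    exact ⟨x, hx⟩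
  choose! x hx using hx
  have h := F.comb_eq_zero_of_sum_eq_zero (lt_add_one a) s x fun y hy => by
    have h1 := congrFun hsum ⟨y, hy⟩
    rw [Finset.sum_apply] at h1
    rw [← h1.trans (Pi.zero_apply _)]
    exact Finset.sum_congr rfl fun ν hν => by rw [← hx ν hν, combMap_apply]
  intro ν hν
  funext y
  rw [← hx ν hν, combMap_apply, h ν hν y y.2, Pi.zero_apply]

/-- Independence of eigenspaces turns the two ranks into natural numbers: `lam` occupies exactly the
indices after the count below it, as many as its multiplicity. -/
theorem isNthEigenvalue_iff {a : ℝ} {bc : (ℝ → ℂ) → (ℝ → ℂ) → Prop}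
    {K : ℝ → Submodule ℂ (ℂ × ℂ)}
    (hbc : ∀ u v u' v' : ℝ → ℂ, (∀ y ∈ Set.Icc a (a + 1), u y = u' y ∧ v y = v' y) →
      bc u v → bc u' v')
    (hK : ∀ ν x, x ∈ K ν ↔ bc (F.comb ν x) (F.combV ν x)) {lam : ℝ} {Z : Finset ℝ}
    (hZ : ∀ ν, ν ∈ Z ↔ ν < lam ∧ Module.finrank ℂ (K ν) ≠ 0) (n : ℕ) :
    c.IsNthEigenvalue k a bc n lam ↔ ∑ ν ∈ Z, Module.finrank ℂ (K ν) < n ∧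
      n ≤ ∑ ν ∈ Z, Module.finrank ℂ (K ν) + Module.finrank ℂ (K lam) := by
  have hspan : ∀ I : Set ℝ, Submodule.span ℂ (⋃ ν ∈ I, c.eigenfunctions k a bc ν) =
      ⨆ ν ∈ I, (K ν).map (F.combMap a ν) := by
    intro I
    rw [Submodule.span_iUnion₂]
    refine iSup_congr fun ν => iSup_congr fun _ => ?_
    rw [F.eigenfunctions_eq hbc (hK ν), Submodule.span_eq]
  have hd : ∀ ν, Module.rank ℂ ((K ν).map (F.combMap a ν)) = (Module.finrank ℂ (K ν) : ℕ) := by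
    intro ν
    rw [Module.finrank_eq_rank]
    exact ((K ν).equivMapOfInjective _ (F.combMap_injective a ν)).rank_eq.symm
  have hlam : lam ∉ Z := fun h => ((hZ lam).1 h).1.false
  have h1 := rank_biSup_eq_sum (F.iSupIndep_map a K) hd (I := Set.Iio lam) (Z := Z)
    (fun ν hν => ((hZ ν).1 hν).1) (fun ν hν h0 => (hZ ν).2 ⟨hν, h0⟩)
  have h2 := rank_biSup_eq_sum (F.iSupIndep_map a K) hd (I := Set.Iic lam) (Z := insert lam Z)
    (fun ν hν => by
      rcases Finset.mem_insert.1 hν with rfl | hν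
      · exact Set.self_mem_Iic
      · exact ((hZ ν).1 hν).1.le)
    (fun ν hν h0 => by
      rcases (Set.mem_Iic.1 hν).lt_or_eq with h | h
      · exact Finset.mem_insert_of_mem ((hZ ν).2 ⟨h, h0⟩)
      · exact h ▸ Finset.mem_insert_self _ _)
  rw [IsNthEigenvalue, hspan, hspan, h1, h2, Finset.sum_insert hlam, add_comm (Module.finrank _ _)]
  norm_cast

end FundamentalSystem

end PeriodicMedium

/-! ### Stopbands and Dirichlet frequencies in terms of the monodromy matrix. -/

namespace PeriodicMedium

namespace FundamentalSystem

variable {c : PeriodicMedium} {k : ℝ} (F : c.FundamentalSystem k)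

/-- Initial values of the solutions with Floquet multiplier `ε`. -/
noncomputable def floquetPlane (ε ν : ℝ) : Submodule ℂ (ℂ × ℂ) :=
  kernelPlane (F.C ν 1 - ε) (F.S ν 1) (F.Cv ν 1) (F.Sv ν 1 - ε)

/-- Coefficients of the solutions which vanish at `a` and `a + 1`. -/
noncomputable def dirichletPlane (a ν : ℝ) : Submodule ℂ (ℂ × ℂ) :=
  kernelPlane (F.C ν a) (F.S ν a) (F.C ν (a + 1)) (F.S ν (a + 1))

theorem mem_floquetPlane {ε K : ℝ} (hK : Complex.exp (Complex.I * K) = ε) (ν : ℝ) (x : ℂ × ℂ) :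
    x ∈ F.floquetPlane ε ν ↔ floquetBC K (F.comb ν x) (F.combV ν x) := by
  rw [floquetPlane, mem_kernelPlane, floquetBC, hK]
  simp only [comb, combV, F.C_zero, F.S_zero, F.Cv_zero, F.Sv_zero]
  push_cast
  constructor
  · rintro ⟨h1, h2⟩
    exact ⟨by linear_combination h1, by linear_combination h2⟩
  · rintro ⟨h1, h2⟩
    exact ⟨by linear_combination h1, by linear_combination h2⟩

theorem mem_dirichletPlane (a ν : ℝ) (x : ℂ × ℂ) :
    x ∈ F.dirichletPlane a ν ↔ dirichletBC a (F.comb ν x) (F.combV ν x) := by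
  rw [dirichletPlane, mem_kernelPlane, dirichletBC]
  simp only [comb, mul_comm]

theorem two_le_finrank_floquetPlane {ε ν : ℝ} :
    2 ≤ Module.finrank ℂ (F.floquetPlane ε ν) ↔ F.IsScalar ε ν := by
  rw [floquetPlane, two_le_finrank_kernelPlane_iff, IsScalar, sub_eq_zero, sub_eq_zero]

theorem finrank_floquetPlane_ne_zero {ε ν : ℝ} (hε : ε ^ 2 = 1) :
    Module.finrank ℂ (F.floquetPlane ε ν) ≠ 0 ↔ ε * F.discriminant ν - 2 = 0 := by
  have hdet : (F.C ν 1 - ε) * (F.Sv ν 1 - ε) - F.S ν 1 * F.Cv ν 1 =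
      -(ε * F.discriminant ν - 2) := by
    rw [discriminant]
    linear_combination F.wronskian ν 1 + hε
  constructor
  · intro h
    by_contra hne
    exact h (finrank_kernelPlane_eq_zero (by rw [hdet]; exact neg_ne_zero.2 hne))
  · intro h
    exact Nat.one_le_iff_ne_zero.1 (one_le_finrank_kernelPlane (by rw [hdet, h, neg_zero]))

/-- Geometric multiplicity equals order of vanishing: 2 in the scalar case, 1 otherwise. -/
theorem exists_floquet_factor {ε z : ℝ} (hε : ε ^ 2 = 1) (hz : ε * F.discriminant z - 2 = 0) :
    ∃ g : ℝ → ℝ, Continuous g ∧ g z ≠ 0 ∧ ∀ l, ε * F.discriminant l - 2 =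
      (l - z) ^ Module.finrank ℂ (F.floquetPlane ε z) * g l := by
  have h1 := (F.finrank_floquetPlane_ne_zero hε).2 hz
  by_cases hs : F.IsScalar ε z
  · have h2 : Module.finrank ℂ (F.floquetPlane ε z) = 2 :=
      le_antisymm finrank_kernelPlane_le_two (F.two_le_finrank_floquetPlane.2 hs)
    obtain ⟨g, hg, hgz, hfg⟩ := F.exists_discriminant_factor_of_isScalar hε hs
    exact ⟨g, hg, hgz.ne, by rwa [h2]⟩
  · have h2 : Module.finrank ℂ (F.floquetPlane ε z) = 1 := by
      have := mt F.two_le_finrank_floquetPlane.1 hs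
      omega
    obtain ⟨g, hg, hgz, hfg⟩ := F.exists_discriminant_factor hε (sub_eq_zero.1 hz) hs
    exact ⟨g, hg, hgz, by simpa only [h2, pow_one] using hfg⟩

/-- `N` counts the eigenvalues below `ω ^ 2`. At a scalar point the final inequality says that `N`
is odd for `ε = 1` and even for `ε = -1`. -/
theorem exists_floquet_count {ε K : ℝ} (hε : ε = 1 ∨ ε = -1)
    (hK : Complex.exp (Complex.I * K) = ε) (ω : ℝ) :
    ∃ N : ℕ, (∀ n, c.IsFloquetFrequency n K k ω ↔
        N < n ∧ n ≤ N + Module.finrank ℂ (F.floquetPlane ε (ω ^ 2))) ∧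
      (F.IsScalar ε (ω ^ 2) → ε * (-1) ^ N ≤ 0) := by
  have hε2 : ε ^ 2 = 1 := by rcases hε with rfl | rfl <;> norm_num
  have hcont : Continuous fun l => ε * F.discriminant l - 2 :=
    (F.continuous_discriminant.const_mul ε).sub continuous_const
  have hneg : ∀ l < 0, 0 < ε * (ε * F.discriminant l - 2) := by
    intro l hl
    have := F.two_lt_discriminant hl
    rcases hε with rfl | rfl <;> linarith
  have hfin : {z | z < ω ^ 2 ∧ ε * F.discriminant z - 2 = 0}.Finite :=
    finite_zeros_of_factor hcont (fun l hl h => by simpa [h] using hneg l hl)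
      (fun z hz => ⟨_, F.exists_floquet_factor hε2 hz⟩) _
  have hZ : ∀ z, z ∈ hfin.toFinset ↔ z < ω ^ 2 ∧ ε * F.discriminant z - 2 = 0 := fun z => by
    rw [Set.Finite.mem_toFinset]
    rfl
  refine ⟨∑ ν ∈ hfin.toFinset, Module.finrank ℂ (F.floquetPlane ε ν), fun n => ?_, fun hs => ?_⟩
  · refine F.isNthEigenvalue_iff (a := 0) (K := F.floquetPlane ε) ?_ (F.mem_floquetPlane hK)
      (fun ν => by rw [hZ, F.finrank_floquetPlane_ne_zero hε2]) n
    rintro u v u' v' h ⟨h1, h2⟩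
    obtain ⟨e1, e2⟩ := h 0 (by norm_num)
    obtain ⟨e3, e4⟩ := h 1 (by norm_num)
    exact ⟨by rw [← e1, ← e3, h1], by rw [← e2, ← e4, h2]⟩
  · obtain ⟨g, hg, hgz, hfg⟩ := F.exists_discriminant_factor_of_isScalar hε2 hs
    refine sign_mul_neg_one_pow_sum_multiplicity hcont hneg ?_ hZ
      (fun z hz => F.exists_floquet_factor hε2 hz)
    filter_upwards [(hg.continuousAt.eventually_lt_const hgz).filter_mono nhdsWithin_le_nhds,
      self_mem_nhdsWithin] with l hl hlt
    rw [hfg]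
    exact mul_neg_of_pos_of_neg (sq_pos_iff.2 (sub_ne_zero.2 (ne_of_lt hlt))) hl

theorem isZeroWidthStopband_iff (ω : ℝ) : c.IsZeroWidthStopband ω k ↔
    F.IsScalar 1 (ω ^ 2) ∨ F.IsScalar (-1) (ω ^ 2) := by
  obtain ⟨N, hN, hNs⟩ := F.exists_floquet_count (ε := 1) (K := 0) (Or.inl rfl) (by simp) ω
  obtain ⟨N', hN', hNs'⟩ := F.exists_floquet_count (ε := -1) (K := Real.pi) (Or.inr rfl)
    (by rw [mul_comm, Complex.exp_pi_mul_I]; simp) ω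
  simp only [IsZeroWidthStopband, hN, hN', ← F.two_le_finrank_floquetPlane] at *
  constructor
  · rintro ⟨n, hn, ⟨h1, h2⟩ | ⟨h1, h2⟩⟩
    · left; omega
    · right; omega
  · rintro (h | h)
    · rcases Nat.even_or_odd N with he | ⟨j, hj⟩
      · have := hNs h
        rw [he.neg_one_pow] at this
        norm_num at this
      -- With `N = 2 j + 1`, the double eigenvalue has indices `2 j + 2` and `2 j + 3`.
      · exact ⟨j + 1, by omega, Or.inl (by omega)⟩
    · rcases Nat.even_or_odd N' with ⟨j, hj⟩ | ho
      -- With `N' = 2 j`, the indices are `2 j + 1` and `2 j + 2`.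
      · exact ⟨j + 1, by omega, Or.inr (by omega)⟩
      · have := hNs' h
        rw [ho.neg_one_pow] at this
        norm_num at this

theorem finrank_dirichletPlane (a ν : ℝ) : Module.finrank ℂ (F.dirichletPlane a ν) =
    if F.dirichletFun a ν = 0 then 1 else 0 := by
  have hdet : F.C ν a * F.S ν (a + 1) - F.S ν a * F.C ν (a + 1) = F.dirichletFun a ν := rfl
  split_ifs with h
  · have h1 : 1 ≤ Module.finrank ℂ (F.dirichletPlane a ν) :=
      one_le_finrank_kernelPlane (hdet.trans h)
    have h2 : ¬ 2 ≤ Module.finrank ℂ (F.dirichletPlane a ν) := by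
      rw [dirichletPlane, two_le_finrank_kernelPlane_iff]
      rintro ⟨e1, e2, -⟩
      have := F.wronskian ν a
      rw [e1, e2] at this
      norm_num at this
    omega
  · exact finrank_kernelPlane_eq_zero (by rw [hdet]; exact h)

theorem dirichletBC_congr (a : ℝ) (u v u' v' : ℝ → ℂ)
    (h : ∀ y ∈ Set.Icc a (a + 1), u y = u' y ∧ v y = v' y) (hb : dirichletBC a u v) :
    dirichletBC a u' v' := by
  have e1 := (h a ⟨le_rfl, by linarith⟩).1
  have e2 := (h (a + 1) ⟨by linarith, le_rfl⟩).1
  exact ⟨by rw [← e1, hb.1], by rw [← e2, hb.2]⟩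

theorem isDirichletFrequency_iff (a ω : ℝ) :
    c.IsDirichletFrequency k a ω ↔ F.dirichletFun a (ω ^ 2) = 0 := by
  have h1 : F.dirichletFun a (ω ^ 2) = 0 ↔ F.dirichletPlane a (ω ^ 2) ≠ ⊥ := by
    rw [← Submodule.one_le_finrank_iff, finrank_dirichletPlane]
    split_ifs with h <;> simp [h]
  rw [h1, IsDirichletFrequency,
    F.eigenfunctions_eq (dirichletBC_congr a) (F.mem_dirichletPlane a (ω ^ 2)),
    Submodule.ne_bot_iff]
  constructor
  · rintro ⟨_, ⟨x, hx, rfl⟩, hne⟩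
    exact ⟨x, hx, fun h => hne (by rw [h, map_zero])⟩
  · rintro ⟨x, hx, hne⟩
    exact ⟨_, ⟨x, hx, rfl⟩, fun h => hne (F.combMap_injective _ _ (h.trans (map_zero _).symm))⟩

theorem isNthDirichletFrequency_iff (a ω : ℝ) (n : ℕ) : c.IsNthDirichletFrequency n k a ω ↔
    {l | l < ω ^ 2 ∧ F.dirichletFun a l = 0}.ncard < n ∧
      n ≤ {l | l < ω ^ 2 ∧ F.dirichletFun a l = 0}.ncard +
        if F.dirichletFun a (ω ^ 2) = 0 then 1 else 0 := by
  have hfin : {l | l < ω ^ 2 ∧ F.dirichletFun a l = 0}.Finite :=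
    finite_zeros_of_factor (F.continuous_dirichletFun.comp
      (by fun_prop : Continuous fun l : ℝ => (a, l))) (fun l hl => F.dirichletFun_ne_zero hl)
      (fun z hz => ⟨1, by simpa using F.exists_dirichletFun_factor hz⟩) _
  have hZ : ∀ z, z ∈ hfin.toFinset ↔ z < ω ^ 2 ∧ F.dirichletFun a z = 0 := fun z => by
    rw [Set.Finite.mem_toFinset]
    rfl
  have h := F.isNthEigenvalue_iff (K := F.dirichletPlane a) (dirichletBC_congr a)
    (F.mem_dirichletPlane a) (lam := ω ^ 2) (Z := hfin.toFinset)
    (fun ν => by rw [hZ, finrank_dirichletPlane]; simp) n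
  have hsum : ∑ ν ∈ hfin.toFinset, Module.finrank ℂ (F.dirichletPlane a ν) =
      {l | l < ω ^ 2 ∧ F.dirichletFun a l = 0}.ncard := by
    rw [Set.ncard_eq_toFinset_card _ hfin, Finset.card_eq_sum_ones]
    refine Finset.sum_congr rfl fun ν hν => ?_
    rw [finrank_dirichletPlane, if_pos ((hZ ν).1 hν).2]
  rw [hsum, finrank_dirichletPlane] at h
  exact h

theorem m₂_eq_zero_iff (ω y : ℝ) : c.m₂ ω k y = 0 ↔ F.dirichletFun y (ω ^ 2) = 0 := by
  rw [c.m₂_eq (F.sol_pinned (ω ^ 2) y) (F.pinned_self _ _) (F.pinnedV_self _ _), neg_eq_zero,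
    Complex.ofReal_eq_zero, dirichletFun]

/-- Translating by one period applies the monodromy matrix, so all dependence on `a` sits in `C lam
a` and `S lam a`. -/
theorem dirichletFun_eq (a lam : ℝ) : F.dirichletFun a lam = F.S lam 1 * F.C lam a ^ 2 +
    (F.Sv lam 1 - F.C lam 1) * (F.C lam a * F.S lam a) - F.Cv lam 1 * F.S lam a ^ 2 := by
  rw [dirichletFun, pinned, (F.translate_S lam a).1, (F.translate_C lam a).1]
  ring

theorem isScalar_iff_dirichletFun (lam : ℝ) : F.IsScalar 1 lam ∨ F.IsScalar (-1) lam ↔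
    ∀ a, F.dirichletFun a lam = 0 := by
  constructor
  · rintro (⟨h1, h2, h3, h4⟩ | ⟨h1, h2, h3, h4⟩) a <;> simp [dirichletFun_eq, h1, h2, h3, h4]
  · intro h
    have hS : F.S lam 1 = 0 := by simpa [dirichletFun_eq, F.C_zero, F.S_zero] using h 0
    have hprod : ∀ a, F.S lam a *
        ((F.Sv lam 1 - F.C lam 1) * F.C lam a + -F.Cv lam 1 * F.S lam a) = 0 := by
      intro a
      have := h a
      rw [dirichletFun_eq, hS] at this
      linear_combination this
    -- Once `S lam 1 = 0`, the form factors through `S lam a`. On an interval where that factor is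
    -- nonzero the other factor vanishes, and independence of `C`, `S` kills its coefficients;
    -- determinant 1 then leaves `ε = 1` or `ε = -1`.
    obtain ⟨p, q, hpq, hne⟩ : ∃ p q, p < q ∧ ∀ a ∈ Set.Icc p q, F.S lam a ≠ 0 := by
      obtain ⟨a, ha⟩ : ∃ a, F.S lam a ≠ 0 := by
        by_contra! hall
        have := F.coeff_eq_zero (lam := lam) (α := 0) (β := 1) zero_lt_one
          fun a _ => by simp [hall a]
        exact one_ne_zero this.2
      obtain ⟨δ, hδ, hball⟩ := Metric.eventually_nhds_iff_ball.1
        ((F.sol_S lam).cont_fst.continuousAt.eventually_ne ha)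
      refine ⟨a, a + δ / 2, by linarith, fun z hz => hball z ?_⟩
      rw [Metric.mem_ball, Real.dist_eq, abs_of_nonneg (by linarith [hz.1])]
      linarith [hz.2]
    have hcoef := F.coeff_eq_zero (lam := lam) (α := F.Sv lam 1 - F.C lam 1)
      (β := -F.Cv lam 1) hpq fun a ha => (mul_eq_zero.1 (hprod a)).resolve_left (hne a ha)
    have hw := F.wronskian lam 1
    rw [hS, mul_zero, sub_zero] at hw
    have h1 : F.Sv lam 1 = F.C lam 1 := sub_eq_zero.1 hcoef.1
    rw [h1] at hw
    have h2 : F.Cv lam 1 = 0 := neg_eq_zero.1 hcoef.2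
    rcases mul_self_eq_one_iff.1 hw with h3 | h3
    · exact Or.inl ⟨h3, hS, h2, h1.trans h3⟩
    · exact Or.inr ⟨h3, hS, h2, h1.trans h3⟩

end FundamentalSystem

end PeriodicMedium

/-! ### The three equivalences. -/

theorem mainTheorem7 (c : PeriodicMedium) (ω k : ℝ) :
    (c.IsZeroWidthStopband ω k ↔ ∀ y : ℝ, c.m₂ ω k y = 0) ∧
    (c.IsZeroWidthStopband ω k ↔ ∀ y : ℝ, c.IsDirichletFrequency k y ω) ∧
    (∀ (n : ℕ) (y₀ : ℝ), 1 ≤ n → c.IsNthDirichletFrequency n k y₀ ω →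
      (c.IsZeroWidthStopband ω k ↔ ∀ y : ℝ, c.IsNthDirichletFrequency n k y ω)) := by
  obtain ⟨F⟩ := c.nonempty_fundamentalSystem k
  have key := (F.isZeroWidthStopband_iff ω).trans (F.isScalar_iff_dirichletFun (ω ^ 2))
  refine ⟨?_, ?_, fun n y₀ _ hy₀ => ?_⟩
  · simp only [F.m₂_eq_zero_iff, key]
  · simp only [F.isDirichletFrequency_iff, key]
  · rw [key]
    constructor
    · intro h y
      have hcard := ncard_zeros_eq F.continuous_dirichletFun
        (fun a l hl => F.dirichletFun_ne_zero hl) h (fun a z hz => F.exists_dirichletFun_factor hz)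
        F.eventually_dirichletFun_injective y y₀
      rw [F.isNthDirichletFrequency_iff, h, if_pos rfl] at hy₀ ⊢
      rwa [hcard]
    -- If `ω ^ 2` were not an eigenvalue at `y`, its multiplicity would be 0 and it would occupy no
    -- index.
    · intro h y
      by_contra hne
      have := (F.isNthDirichletFrequency_iff y ω n).1 (h y)
      rw [if_neg hne] at this
      omega
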